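/- **Lemma (Division lemma).** Write points of $\mathbf R^4$ as $(t,x)$ with $t=x_0\in\mathbf R$, $x\in\mathbf R^3$, and put $\partial_0=\partial_t$, $\partial_j=\partial_{x_j}$ for $j=1,2,3$, $\partial_{ij}^2=\partial_i\partial_j$. Let $Y\in\mathcal D'(\mathbf R^4)$ be the forward fundamental solution of the wave operator $\Box=\partial_t^2-\Delta_x$, characterized by $$\Box Y=\delta_{(0,0)},\qquad \operatorname{supp}Y\subset\{(t,x)\in\mathbf R^4 : |x|\le t\}.$$ For $m\in\mathbf Z$ let $\mathcal M_m$ be the space of $C^\infty$ functions on $\mathbf R^4\setminus 0$ that are homogeneous of degree $m$ (that is, $f(\lambda z)=\lambda^m f(z)$ for all $\lambda>0$ and $z\neq0$). A distribution $F$ on $\mathbf R^4$ is homogeneous of degree $m$ if $\langle F,\phi(\cdot/\lambda)\rangle=\lambda^{m+4}\langle F,\phi\rangle$ for all $\lambda>0$ and $\phi\in C^\infty_c(\mathbf R^4)$. Let $v\in\mathbf R^3$ with $|v|<1$, and let $T=\partial_t+v\cdot\nabla_x$. 1. There exist functions $a_i^k\in\mathcal M_{-k}$, for $i=0,\dots,3$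 and $k=0,1$, such that $$\partial_iY=T(a_i^0Y)+a_i^1Y,\qquad i=0,\dots,3.$$ 2. There exist functions $b_{ij}^k\in\mathcal M_{-k}$, for $i,j=0,\dots,3$ and $k=0,1,2$, such that $$\partial_{ij}^2Y=T^2(b_{ij}^0Y)+T(b_{ij}^1Y)+b_{ij}^2Y,\qquad i,j=0,\dots,3.$$ 3. Moreover, these functions $b_{ij}^2$ satisfy $$\int_{\mathbf S^2}b_{ij}^2(1,y)\,d\sigma(y)=0,\qquad i,j=0,\dots,3,$$ where $d\sigma$ is the rotation invariant surface element on the unit sphere $\mathbf S^2$ of $\mathbf R^3$. Both formulas are equalities of distributions on $\mathbf R^4$. A product of $Y$ with one of the functions above is a priori defined only as a distribution on $\mathbf R^4\setminus 0$. In the formulas, $a_i^kY$ and $b_{ij}^kY$ with $k=0,1$ designate the unique extensions of these products to $\mathbf R^4$ as homogeneous distributions of degree $-2-k$, and $b_{ij}^2Y$ designates the unique extension to $\mathbf R^4$, as a homogeneous distribution of degree $-4$, for which the second formula holds; the existence and uniqueness of these extensions is part of the assertion. -/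

import Mathlib

open TopologicalSpace MeasureTheory
open scoped Distributions LineDeriv ContDiff

namespace WaveDivision

/-- Euclidean space `ℝ³`. -/
abbrev Space : Type := EuclideanSpace ℝ (Fin 3)

/-- Space-time `ℝ⁴ = ℝ × ℝ³`, with points `(t, x)`. -/
abbrev SpaceTime : Type := ℝ × Space

/-- The open set `ℝ⁴ ∖ 0`. -/
def punctured : Opens SpaceTime := ⟨{0}ᶜ, isOpen_compl_singleton⟩

/-- Test functions on `ℝ⁴`. -/
abbrev Test : Type := 𝓓((⊤ : Opens SpaceTime), ℝ)

/-- Test functions on `ℝ⁴ ∖ 0`. -/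
abbrev PuncturedTest : Type := 𝓓(punctured, ℝ)

/-- Distributions on `ℝ⁴`. -/
abbrev Dist : Type := 𝓓'((⊤ : Opens SpaceTime), ℝ)

/-- The coordinate directions of `ℝ⁴`: index `0` is time, the indices `1, 2, 3` are space. -/
noncomputable def dir : Fin 4 → SpaceTime :=
  Fin.cons (1, 0) (fun j : Fin 3 => (0, EuclideanSpace.single j 1))

/-- The partial derivative `∂ᵢ` of a distribution, with `∂₀ = ∂ₜ`. -/
noncomputable def partialD (i : Fin 4) (F : Dist) : Dist := ∂_{dir i} F

/-- The wave operator `□ = ∂ₜ² - ∂₁² - ∂₂² - ∂₃²` on distributions. -/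
noncomputable def box (F : Dist) : Dist :=
  partialD 0 (partialD 0 F) - ∑ j : Fin 3, partialD j.succ (partialD j.succ F)

/-- The streaming operator `T = ∂ₜ + v · ∇ₓ` on distributions. -/
noncomputable def stream (v : Space) (F : Dist) : Dist :=
  partialD 0 F + ∑ j : Fin 3, v j • partialD j.succ F

/-- `Y` is the forward fundamental solution of the wave operator:
`□ Y = δ₀` and `supp Y ⊆ {|x| ≤ t}`. -/
def IsForwardFundamentalSolution (Y : Dist) : Prop :=
  box Y = Distribution.delta 0 ∧
    Distribution.dsupport Y ⊆ {z : SpaceTime | ‖z.2‖ ≤ z.1}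

/-- The space `M_m` of smooth functions on `ℝ⁴ ∖ 0` that are (positively) homogeneous of degree
`m`. The value at the origin plays no role. -/
structure HomogeneousFunction (m : ℤ) where
  toFun : SpaceTime → ℝ
  smooth : ContDiffOn ℝ ∞ toFun {0}ᶜ
  homogeneous : ∀ (c : ℝ) (z : SpaceTime), 0 < c → z ≠ 0 → toFun (c • z) = c ^ m * toFun z

instance (m : ℤ) : CoeFun (HomogeneousFunction m) (fun _ => SpaceTime → ℝ) :=
  ⟨HomogeneousFunction.toFun⟩

/-- The dilation `M_c φ (z) = φ (z / c)` of a test function. -/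
noncomputable def dilate (c : ℝ) (hc : c ≠ 0) (φ : Test) : Test where
  toFun := fun z => φ (c⁻¹ • z)
  contDiff' := φ.contDiff.comp (contDiff_const_smul c⁻¹)
  hasCompactSupport' :=
    φ.hasCompactSupport.comp_homeomorph (Homeomorph.smulOfNeZero c⁻¹ (inv_ne_zero hc))
  tsupport_subset' := fun _ _ => trivial

/-- A distribution `F` on `ℝ⁴` is homogeneous of degree `m` if
`⟨F, M_c φ⟩ = c ^ (m + 4) ⟨F, φ⟩` for all `c > 0` and all test functions `φ`. -/
def IsHomogeneous (m : ℤ) (F : Dist) : Prop :=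
  ∀ (c : ℝ) (hc : 0 < c) (φ : Test), F (dilate c hc.ne' φ) = c ^ (m + 4) * F φ

/-- The extension by zero of a test function on `ℝ⁴ ∖ 0` to a test function on `ℝ⁴`. -/
noncomputable def extend (φ : PuncturedTest) : Test where
  toFun := φ
  contDiff' := φ.contDiff
  hasCompactSupport' := φ.hasCompactSupport
  tsupport_subset' := fun _ _ => trivial

/-- The product of `a ∈ M_m` with a test function on `ℝ⁴ ∖ 0`, again a test function
on `ℝ⁴ ∖ 0`. -/
noncomputable def HomogeneousFunction.mulTest {m : ℤ} (a : HomogeneousFunction m) (φ : PuncturedTest) :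
    PuncturedTest where
  toFun := fun z => a z * φ z
  contDiff' := by
    rw [contDiff_iff_contDiffAt]
    intro z
    by_cases hz : z ∈ tsupport φ
    · have hz0 : z ∈ ({0}ᶜ : Set SpaceTime) := φ.tsupport_subset hz
      exact (a.smooth.contDiffAt (isOpen_compl_singleton.mem_nhds hz0)).mul φ.contDiff.contDiffAt
    · refine (contDiffAt_const (c := (0 : ℝ))).congr_of_eventuallyEq ?_
      filter_upwards [(isClosed_tsupport φ).isOpen_compl.mem_nhds hz] with w hw
      simp [image_eq_zero_of_notMem_tsupport hw]
  hasCompactSupport' := φ.hasCompactSupport.mul_left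
  tsupport_subset' := (tsupport_mul_subset_right).trans φ.tsupport_subset

/-- `F` coincides on `ℝ⁴ ∖ 0` with the product `a Y`, that is with the distribution
`φ ↦ ⟨Y, a φ⟩` on `ℝ⁴ ∖ 0`. -/
def ExtendsProduct {k : ℤ} (a : HomogeneousFunction k) (Y F : Dist) : Prop :=
  ∀ φ : PuncturedTest, F (extend φ) = Y (extend (a.mulTest φ))

/-- `F` is a homogeneous distribution of degree `m` on `ℝ⁴` that extends the distribution `a Y`
on `ℝ⁴ ∖ 0`. -/
def IsHomogeneousExtension (m : ℤ) {k : ℤ} (a : HomogeneousFunction k) (Y F : Dist) : Prop :=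
  IsHomogeneous m F ∧ ExtendsProduct a Y F

/-- `F` is the unique homogeneous distribution of degree `m` on `ℝ⁴` that extends the
distribution `a Y` on `ℝ⁴ ∖ 0`. -/
def IsUniqueHomogeneousExtension (m : ℤ) {k : ℤ} (a : HomogeneousFunction k) (Y F : Dist) :
    Prop :=
  IsHomogeneousExtension m a Y F ∧ ∀ G : Dist, IsHomogeneousExtension m a Y G → G = F

/-- The rotation invariant surface measure on the unit sphere `S²` of `ℝ³` (total mass `4π`). -/
noncomputable def surfaceMeasure : Measure (Metric.sphere (0 : Space) 1) :=
  (volume : Measure Space).toSphere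

end WaveDivision

namespace WaveDivision

open Set Filter Topology Measure

/-! ### Test functions -/

/-! The support condition and `□ Y = δ₀` force `Y` to be the measure `dx / (4π|x|)` on the cone `t =
|x|` (`IsForwardFundamentalSolution.apply_eq`). Everything then becomes calculus on that cone. The
Lorentz boosts `Lⱼ = xⱼ ∂ₜ + t ∂ⱼ` are tangent to the cone and integrate to zero against this
measure (`coneForm_boost`). Since `|v| < 1`, the field `T` is transversal to the cone away from its
vertex, so there every `∂ᵢ` equals `aᵢ⁰ T - ∑ⱼ cᵢⱼ Lⱼ` with homogeneous coefficients
(`lineDeriv_cone`). Integrating the boosts by parts moves them onto the `cᵢⱼ`, and `aᵢ¹ = -∑ⱼ Lⱼ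
cᵢⱼ` gives the first formula off the origin. Applying it twice gives the second one off the origin.
To cross the origin: a homogeneous distribution of degree `> -4` supported at `0` vanishes
(`eq_zero_of_isHomogeneous`). This gives uniqueness of the extensions in degrees `-2` and `-3`, as
well as the first formula. Existence holds because the densities are locally integrable on the cone.
In degree `-4` neither argument applies: the extension of `bᵢⱼ² Y` is instead defined as what the
second formula leaves over, so it is unique by construction. The existence of a degree `-4`
extension is itself what makes `bᵢⱼ²` have mean zero. Such an extension takes the same value on `χ`
and on `χ(·/2)`, hence kills their difference, which is a test function off the origin when `χ = 1`
near `0`. For radial `χ`, polar coordinates turn this into the spherical mean times a nonzero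
constant (`IsHomogeneousExtension.integral_sphere_eq_zero`). -/

/-- A smooth function with compact support, as a test function on `ℝ⁴`. -/
noncomputable def mkTest (f : SpaceTime → ℝ) (hf : ContDiff ℝ ∞ f) (hc : HasCompactSupport f) :
    Test :=
  ⟨f, hf, hc, fun _ _ => trivial⟩

@[simp]
lemma mkTest_apply (f : SpaceTime → ℝ) (hf : ContDiff ℝ ∞ f) (hc : HasCompactSupport f)
    (z : SpaceTime) : mkTest f hf hc z = f z := rfl

@[simp]
lemma extend_apply (φ : PuncturedTest) (z : SpaceTime) : extend φ z = φ z := rfl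

@[simp]
lemma dilate_apply (c : ℝ) (hc : c ≠ 0) (φ : Test) (z : SpaceTime) :
    dilate c hc φ z = φ (c⁻¹ • z) := rfl

@[simp]
lemma HomogeneousFunction.mulTest_apply {m : ℤ} (a : HomogeneousFunction m) (φ : PuncturedTest)
    (z : SpaceTime) : a.mulTest φ z = a z * φ z := rfl

lemma lineDeriv_test_apply {Ω : Opens SpaceTime} (φ : 𝓓(Ω, ℝ)) (w z : SpaceTime) :
    (∂_{w} φ) z = fderiv ℝ φ z w := by
  rw [TestFunction.lineDerivOp_eq_lineDerivCLM ℝ, TestFunction.lineDerivCLM_eq_fderivCLM,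
    TestFunction.fderivCLM_apply_of_le _ (by simp)]

lemma differentiable_test {Ω : Opens SpaceTime} (φ : 𝓓(Ω, ℝ)) : Differentiable ℝ φ :=
  φ.contDiff.differentiable (by simp)

lemma extend_lineDeriv (φ : PuncturedTest) (w : SpaceTime) :
    extend (∂_{w} φ) = ∂_{w} (extend φ) := by
  ext z
  rw [extend_apply, lineDeriv_test_apply, lineDeriv_test_apply]
  rfl

lemma lineDeriv_dist_apply (w : SpaceTime) (F : Dist) (φ : Test) : (∂_{w} F) φ = -F (∂_{w} φ) := by
  rw [Distribution.lineDerivOp_apply_apply, map_neg]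

lemma dir_zero : dir 0 = (1, 0) := rfl

lemma dir_succ (j : Fin 3) : dir j.succ = (0, EuclideanSpace.single j 1) := rfl

lemma stream_eq (v : Space) (F : Dist) : stream v F = ∂_{((1, v) : SpaceTime)} F := by
  have h : ((1, v) : SpaceTime) = dir 0 + ∑ j : Fin 3, v j • dir j.succ := by
    simp only [dir_zero, dir_succ, Fin.sum_univ_three]
    ext j
    · simp
    · fin_cases j <;> simp
  rw [h, LineDeriv.lineDerivOp_left_add, stream]
  congr 1
  simp only [Fin.sum_univ_three, LineDeriv.lineDerivOp_left_add, LineDeriv.lineDerivOp_left_smul,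
    partialD]

/-! ### Distributions vanish off their support -/

/-- A two-piece partition of unity: the parts of `tsupport u` outside `s` and outside `t` are
disjoint closed sets, so a smooth `f` can be `0` near the first and `1` near the second. Then `f u`
lives in `s` and `(1 - f) u` in `t`. -/
lemma isVanishingOn_union {F : Dist} {s t : Set SpaceTime} (hs : IsOpen s) (ht : IsOpen t)
    (hFs : Distribution.IsVanishingOn F s) (hFt : Distribution.IsVanishingOn F t) :
    Distribution.IsVanishingOn F (s ∪ t) := by
  intro u hu
  have hcl : IsClosed (tsupport u) := isClosed_tsupport u
  obtain ⟨f, h0, h1, -⟩ := exists_contMDiffMap_zero_one_nhds_of_isClosed (n := ⊤)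
    (modelWithCornersSelf ℝ SpaceTime) (hcl.sdiff hs) (hcl.sdiff ht) (by
      rw [Set.disjoint_left]
      rintro x ⟨hx, hxs⟩ ⟨-, hxt⟩
      exact (hu hx).elim hxs hxt)
  have hf : ContDiff ℝ ∞ f := f.contMDiff.contDiff
  rw [eventually_nhdsSet_iff_forall] at h0 h1
  let p : Test := mkTest (fun z => f z * u z) (hf.mul u.contDiff) u.hasCompactSupport.mul_left
  let q : Test := mkTest (fun z => (1 - f z) * u z) ((contDiff_const.sub hf).mul u.contDiff)
    u.hasCompactSupport.mul_left
  have hpq : u = p + q := by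
    ext z
    change u z = f z * u z + (1 - f z) * u z
    ring
  have hp : F p = 0 := by
    refine hFs p fun x hx => ?_
    by_contra hxs
    refine (notMem_tsupport_iff_eventuallyEq.2 ?_) hx
    filter_upwards [h0 x ⟨tsupport_mul_subset_right hx, hxs⟩] with y hy
    simp [p, hy]
  have hq : F q = 0 := by
    refine hFt q fun x hx => ?_
    by_contra hxs
    refine (notMem_tsupport_iff_eventuallyEq.2 ?_) hx
    filter_upwards [h1 x ⟨tsupport_mul_subset_right hx, hxs⟩] with y hy
    simp [q, hy]
  rw [hpq, map_add, hp, hq, add_zero]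

/-- The support is defined pointwise by local vanishing. Compactness of `tsupport u` and the gluing
of two open sets make it global. -/
lemma isVanishingOn_compl_dsupport (F : Dist) :
    Distribution.IsVanishingOn F (Distribution.dsupport F)ᶜ := by
  intro u hu
  suffices h : ∃ V, IsOpen V ∧ tsupport u ⊆ V ∧ Distribution.IsVanishingOn F V by
    obtain ⟨V, -, h1, h2⟩ := h
    exact h2 u h1
  have hK : IsCompact (tsupport u) := u.hasCompactSupport
  refine hK.induction_on (p := fun S => ∃ V, IsOpen V ∧ S ⊆ V ∧ Distribution.IsVanishingOn F V)
    ⟨∅, isOpen_empty, subset_rfl, fun w hw => ?_⟩ ?_ ?_ ?_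
  · have : w = 0 := by
      ext z
      exact image_eq_zero_of_notMem_tsupport fun h => hw h
    rw [this, map_zero]
  · rintro s t hst ⟨V, h1, h2, h3⟩
    exact ⟨V, h1, hst.trans h2, h3⟩
  · rintro s t ⟨V, h1, h2, h3⟩ ⟨W, k1, k2, k3⟩
    exact ⟨V ∪ W, h1.union k1, union_subset_union h2 k2, isVanishingOn_union h1 k1 h3 k3⟩
  · intro x hx
    obtain ⟨V, h1, h2, h3⟩ := (Distribution.notMem_dsupport_iff x).1 (hu hx)
    exact ⟨V, mem_nhdsWithin_of_mem_nhds (h2.mem_nhds h3), V, h2, subset_rfl, h1⟩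

/-! ### Homogeneous distributions -/

lemma IsHomogeneous.sub {m : ℤ} {F G : Dist} (hF : IsHomogeneous m F) (hG : IsHomogeneous m G) :
    IsHomogeneous m (F - G) := by
  intro c hc φ
  change F _ - G _ = _ * (F φ - G φ)
  rw [hF c hc, hG c hc]
  ring

lemma IsHomogeneous.lineDeriv {m n : ℤ} (hmn : m - 1 = n) {F : Dist} (hF : IsHomogeneous m F)
    (w : SpaceTime) : IsHomogeneous n (∂_{w} F) := by
  intro c hc φ
  have h : ∂_{w} (dilate c hc.ne' φ) = c⁻¹ • dilate c hc.ne' (∂_{w} φ) := by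
    ext z
    change _ = c⁻¹ • (∂_{w} φ) (c⁻¹ • z)
    rw [lineDeriv_test_apply, lineDeriv_test_apply]
    have h1 : HasFDerivAt (dilate c hc.ne' φ)
        ((fderiv ℝ φ (c⁻¹ • z)).comp (c⁻¹ • ContinuousLinearMap.id ℝ SpaceTime)) z :=
      (differentiable_test φ (c⁻¹ • z)).hasFDerivAt.comp z
        ((c⁻¹ • ContinuousLinearMap.id ℝ SpaceTime).hasFDerivAt)
    rw [h1.fderiv]
    simp
  rw [lineDeriv_dist_apply, lineDeriv_dist_apply, h, map_smul, hF c hc, smul_eq_mul, ← hmn,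
    show m - 1 + 4 = m + 4 - 1 by ring, zpow_sub_one₀ hc.ne']
  ring

/-- A homogeneous distribution of degree `> -4` that vanishes off the origin is zero. -/
lemma eq_zero_of_isHomogeneous {m : ℤ} (hm : -4 < m) {G : Dist} (hG : IsHomogeneous m G)
    (h0 : ∀ φ : PuncturedTest, G (extend φ) = 0) : G = 0 := by
  ext φ
  change G φ = 0
  -- Since `G` only sees a neighbourhood of `0`, it takes the same value on `φ(·/c)` and on `χ
  -- φ(·/c)`. As `c → ∞` the latter stay bounded in one fixed `𝓓_K`, whereas homogeneity makes the
  -- value grow like `c ^ (m + 4)` unless `G φ = 0`.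
  let χ : ContDiffBump (0 : SpaceTime) := ⟨1, 2, one_pos, one_lt_two⟩
  let K : Compacts SpaceTime := ⟨tsupport χ, χ.hasCompactSupport⟩
  have hsm : ∀ c : ℝ, ContDiff ℝ ∞ fun z => φ (c • z) := fun c =>
    φ.contDiff.comp (contDiff_const_smul c)
  let g : ℝ → 𝓓_{K}(SpaceTime, ℝ) := fun c => ContDiffMapSupportedIn.of_support_subset
    (f := fun z => χ z * φ (c • z)) (χ.contDiff.mul (hsm c))
    ((Function.support_mul_subset_left _ _).trans subset_closure)
  have hg : ∀ c z, g c z = χ z * φ (c • z) := fun c z => rfl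
  let ι := TestFunction.ofSupportedInCLM ℝ (n := ⊤) (F := ℝ) (Ω := (⊤ : Opens SpaceTime)) (K := K)
    (fun _ _ => trivial)
  let A : 𝓓_{K}(SpaceTime, ℝ) →L[ℝ] ℝ :=
    ⟨G.toLinearMap.comp ι.toLinearMap, G.continuous.comp ι.continuous⟩
  have hA : ∀ c, ∀ hc : 0 < c, A (g c⁻¹) = c ^ (m + 4) * G φ := by
    intro c hc
    rw [← hG c hc φ]
    change G (ι (g c⁻¹)) = _
    let d : PuncturedTest := ⟨fun z => (1 - χ z) * φ (c⁻¹ • z),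
      (contDiff_const.sub χ.contDiff).mul (hsm c⁻¹),
      (dilate c hc.ne' φ).hasCompactSupport.mul_left, by
        intro z hz hz0
        rw [mem_singleton_iff] at hz0
        subst hz0
        refine (notMem_tsupport_iff_eventuallyEq.2 ?_) hz
        filter_upwards [χ.eventuallyEq_one] with y hy
        simp [hy]⟩
    have h1 : dilate c hc.ne' φ = ι (g c⁻¹) + extend d := by
      ext z
      change φ (c⁻¹ • z) = χ z * φ (c⁻¹ • z) + (1 - χ z) * φ (c⁻¹ • z)
      ring
    rw [h1, map_add, h0, add_zero]
  obtain ⟨s, C, -, hC⟩ := Seminorm.bound_of_continuous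
    (ContDiffMapSupportedIn.withSeminorms ℝ SpaceTime ℝ ⊤ K) ((normSeminorm ℝ ℝ).comp A.toLinearMap)
    (continuous_norm.comp A.continuous)
  have hbd : ∀ f : SpaceTime → ℝ, ContDiff ℝ ∞ f → HasCompactSupport f →
      ∀ i : ℕ, ∃ B : ℝ, ∀ z, ‖iteratedFDeriv ℝ i f z‖ ≤ B := by
    intro f hf hc i
    exact (hf.continuous_iteratedFDeriv (by exact_mod_cast le_top)).bounded_above_of_compact_support
      (hc.iteratedFDeriv i)
  choose Bχ hBχ using hbd χ χ.contDiff χ.hasCompactSupport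
  choose Bφ hBφ using hbd φ φ.contDiff φ.hasCompactSupport
  let M : ℕ → ℝ := fun n => ∑ i ∈ Finset.range (n + 1), (n.choose i : ℝ) * Bχ i * Bφ (n - i)
  have hBχ0 : ∀ i, 0 ≤ Bχ i := fun i => (norm_nonneg _).trans (hBχ i 0)
  have hBφ0 : ∀ i, 0 ≤ Bφ i := fun i => (norm_nonneg _).trans (hBφ i 0)
  have hM0 : ∀ n, 0 ≤ M n := fun n => Finset.sum_nonneg fun i _ =>
    mul_nonneg (mul_nonneg (Nat.cast_nonneg _) (hBχ0 _)) (hBφ0 _)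
  -- Each derivative of `φ(c ·)` of order `k` carries a factor `c ^ k`, at most `1` in absolute
  -- value, so Leibniz gives a bound independent of `c`.
  have hsemi : ∀ c : ℝ, |c| ≤ 1 → ∀ n : ℕ,
      ContDiffMapSupportedIn.seminorm ℝ SpaceTime ℝ ⊤ K n (g c) ≤ M n := by
    intro c hc n
    rw [ContDiffMapSupportedIn.seminorm_top_le_iff ℝ (hM0 n)]
    intro z _
    refine (norm_iteratedFDeriv_mul_le χ.contDiff (hsm c) z
      (n := n) (by exact_mod_cast le_top)).trans ?_
    refine Finset.sum_le_sum fun i _ => ?_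
    have h2 : ‖iteratedFDeriv ℝ (n - i) (fun z => φ (c • z)) z‖ ≤ Bφ (n - i) := by
      generalize n - i = k
      rw [iteratedFDeriv_comp_const_smul c (φ.contDiff.of_le (by exact_mod_cast le_top)), norm_smul,
        norm_pow]
      calc ‖c‖ ^ k * ‖iteratedFDeriv ℝ k φ (c • z)‖
          ≤ 1 * Bφ k :=
            mul_le_mul (pow_le_one₀ (norm_nonneg _) hc) (hBφ _ _) (norm_nonneg _) zero_le_one
        _ = _ := one_mul _
    exact mul_le_mul (mul_le_mul_of_nonneg_left (hBχ _ _) (Nat.cast_nonneg _)) h2 (norm_nonneg _)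
      (mul_nonneg (Nat.cast_nonneg _) (hBχ0 _))
  obtain ⟨B, hB⟩ : ∃ B : ℝ, ∀ c : ℝ, |c| ≤ 1 → |A (g c)| ≤ B := by
    refine ⟨C * ∑ n ∈ s, M n, fun c hc => (hC (g c)).trans ?_⟩
    change (C : ℝ) * _ ≤ _
    refine mul_le_mul_of_nonneg_left ?_ C.2
    refine Seminorm.finset_sup_apply_le (Finset.sum_nonneg fun n _ => hM0 n) fun n hn => ?_
    exact (hsemi c hc n).trans (Finset.single_le_sum (fun n _ => hM0 n) hn)
  by_contra hne
  have hlim : Tendsto (fun c : ℝ => c * |G φ|) atTop atTop :=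
    tendsto_id.atTop_mul_const (abs_pos.2 hne)
  obtain ⟨c, hc1, hcB⟩ := ((eventually_ge_atTop (1 : ℝ)).and (hlim.eventually_gt_atTop B)).exists
  have hc0 : 0 < c := one_pos.trans_le hc1
  have h1 := hB c⁻¹ (by rw [abs_of_pos (inv_pos.2 hc0)]; exact inv_le_one_of_one_le₀ hc1)
  rw [hA c hc0, abs_mul, abs_of_pos (zpow_pos hc0 _)] at h1
  have h2 : c ≤ c ^ (m + 4) := by
    calc c = c ^ (1 : ℤ) := (zpow_one c).symm
      _ ≤ _ := zpow_le_zpow_right₀ hc1 (by omega)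
  linarith [mul_le_mul_of_nonneg_right h2 (abs_nonneg (G φ))]

/-- A homogeneous extension of degree `> -4` is unique. -/
lemma IsHomogeneousExtension.unique {m k : ℤ} (hm : -4 < m) {a : HomogeneousFunction k}
    {Y F : Dist} (hF : IsHomogeneousExtension m a Y F) : IsUniqueHomogeneousExtension m a Y F := by
  refine ⟨hF, fun G hG => sub_eq_zero.1 (eq_zero_of_isHomogeneous hm (hG.1.sub hF.1) fun φ => ?_)⟩
  change G _ - F _ = 0
  rw [hG.2, hF.2, sub_self]

/-! ### The integral of a derivative, with a singular point -/

/-- Only the line over `0 : E` meets the singular point, and `ν` does not charge it. On almost every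
other line both functions are integrable and the one-dimensional theorem applies. -/
lemma integral_prod_eq_zero_of_hasLineDerivAt {E : Type*} [NormedAddCommGroup E]
    [NormedSpace ℝ E] [MeasurableSpace E] {ν : Measure E} [SigmaFinite ν] [NullSingletonClass ν]
    {f f' : E × ℝ → ℝ} (hf : Integrable f (ν.prod volume)) (hf' : Integrable f' (ν.prod volume))
    (hd : ∀ x ≠ 0, HasLineDerivAt ℝ f (f' x) x (0, 1)) :
    ∫ x, f' x ∂(ν.prod volume) = 0 := by
  rw [integral_prod _ hf']
  have h : ∀ᵐ y ∂ν, ∫ t, f' (y, t) = 0 := by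
    filter_upwards [hf.prod_right_ae, hf'.prod_right_ae, measure_eq_zero_iff_ae_notMem.1
      (measure_singleton (μ := ν) (0 : E))] with y h1 h2 hy
    refine integral_eq_zero_of_hasDerivAt_of_integrable (fun t => ?_) h2 h1
    have hne : ((y, t) : E × ℝ) ≠ 0 := fun h => hy (congrArg Prod.fst h)
    convert! (hd (y, t) hne).scomp_of_eq t ((hasDerivAt_id t).add (hasDerivAt_const t (-t)))
      (by simp) <;> simp
  rw [integral_congr_ae h, integral_zero]

/-- If `f` and its derivative `f'` along `v` are integrable, where the derivative exists off the
origin, then `f'` has integral zero. -/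
lemma integral_eq_zero_of_hasLineDerivAt {E : Type*} [NormedAddCommGroup E]
    [NormedSpace ℝ E] [MeasurableSpace E] [BorelSpace E] [FiniteDimensional ℝ E]
    (hE : 2 ≤ Module.finrank ℝ E) {μ : Measure E} [IsAddHaarMeasure μ] {v : E} (hv : v ≠ 0)
    {f f' : E → ℝ} (hf : Integrable f μ) (hf' : Integrable f' μ)
    (hd : ∀ x ≠ 0, HasLineDerivAt ℝ f (f' x) x v) : ∫ x, f' x ∂μ = 0 := by
  let n := Module.finrank ℝ E
  let E' := Fin (n - 1) → ℝ
  -- Dimension at least two leaves a nontrivial transversal space `E'`, whose Lebesgue measure has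
  -- no atoms. A linear change of variables sends `v` to the last axis.
  have : Nontrivial E' := by
    have : Nonempty (Fin (n - 1)) := ⟨⟨0, by omega⟩⟩
    infer_instance
  obtain ⟨L, hL⟩ : ∃ L : E ≃L[ℝ] (E' × ℝ), L v = (0, 1) := by
    have : Module.finrank ℝ E = Module.finrank ℝ (E' × ℝ) := by simp [E', n]; omega
    have L₀ : E ≃L[ℝ] (E' × ℝ) := ContinuousLinearEquiv.ofFinrankEq this
    obtain ⟨M, hM⟩ : ∃ M : (E' × ℝ) ≃L[ℝ] (E' × ℝ), M (L₀ v) = (0, 1) := by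
      apply SeparatingDual.exists_continuousLinearEquiv_apply_eq
      · simpa using hv
      · simp
    exact ⟨L₀.trans M, by simp [hM]⟩
  let ν := Measure.map L μ
  have : IsAddHaarMeasure ν := L.isAddHaarMeasure_map μ
  have L_emb : MeasurableEmbedding L := L.toHomeomorph.measurableEmbedding
  have e : ∀ g : E → ℝ, Integrable g μ →
      Integrable (g ∘ L.symm) ((volume : Measure E').prod (volume : Measure ℝ)) := by
    intro g hg
    have h1 : Integrable (g ∘ L.symm) ν := by
      rw [L_emb.integrable_map_iff]
      simpa [Function.comp_def] using hg
    rw [isAddLeftInvariant_eq_smul ((volume : Measure E').prod (volume : Measure ℝ)) ν]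
    exact h1.smul_measure_nnreal
  have h := integral_prod_eq_zero_of_hasLineDerivAt (e f hf) (e f' hf') fun x hx => by
    have h2 := hd (L.symm x) (by simpa using hx)
    have : f = (f ∘ L.symm) ∘ (L : E →ₗ[ℝ] (E' × ℝ)) := by ext y; simp
    rw [this] at h2
    convert! h2.of_comp using 1
    · simp
    · simp [← hL]
  have h3 : ∫ x, (f' ∘ L.symm) x ∂ν = ∫ x, f' x ∂μ := by
    rw [L_emb.integral_map]
    simp
  rw [← h3, isAddLeftInvariant_eq_smul ν ((volume : Measure E').prod (volume : Measure ℝ)),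
    integral_smul_nnreal_measure, h, smul_zero]

/-! ### Polar coordinates -/

lemma integral_polar {f : Space → ℝ} (hf : Integrable f) :
    ∫ x, f x = ∫ y : Metric.sphere (0 : Space) 1, (∫ r in Ioi (0 : ℝ), r ^ 2 * f (r • (y : Space)))
      ∂surfaceMeasure := by
  have hfin : Module.finrank ℝ Space - 1 = 2 := by simp [Space]
  have hmp := (volume : Measure Space).measurePreserving_homeomorphUnitSphereProd
  rw [hfin] at hmp
  have hemb := (homeomorphUnitSphereProd Space).measurableEmbedding
  let F : Metric.sphere (0 : Space) 1 × Ioi (0 : ℝ) → ℝ := fun p => f (p.2.1 • p.1.1)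
  have hF : ∀ x : ({0}ᶜ : Set Space), F (homeomorphUnitSphereProd Space x) = f x := by
    rintro ⟨x, hx⟩
    have : ‖x‖ ≠ 0 := norm_ne_zero_iff.2 hx
    simp [F, smul_smul, mul_inv_cancel₀ this]
  have hint : Integrable F (surfaceMeasure.prod (volumeIoiPow 2)) := by
    rw [surfaceMeasure, ← hmp.integrable_comp_emb hemb]
    have : F ∘ homeomorphUnitSphereProd Space = fun x : ({0}ᶜ : Set Space) => f x := funext hF
    rw [this]
    have h2 : IntegrableOn f ({0}ᶜ : Set Space) := hf.integrableOn
    rwa [integrableOn_iff_comap_subtypeVal (measurableSet_singleton _).compl] at h2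
  have hS : SFinite surfaceMeasure := by unfold surfaceMeasure; infer_instance
  calc ∫ x, f x = ∫ x : ({0}ᶜ : Set Space), f x ∂((volume : Measure Space).comap (↑)) := by
        rw [integral_subtype_comap (measurableSet_singleton _).compl f,
          restrict_compl_singleton]
    _ = ∫ p, F p ∂(surfaceMeasure.prod (volumeIoiPow 2)) := by
        rw [surfaceMeasure, ← hmp.integral_comp hemb]
        exact integral_congr_ae (Eventually.of_forall fun x => (hF x).symm)
    _ = ∫ y, ∫ r, F (y, r) ∂(volumeIoiPow 2) ∂surfaceMeasure := integral_prod _ hint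
    _ = _ := by
        refine integral_congr_ae (Eventually.of_forall fun y => ?_)
        simp only [Measure.volumeIoiPow, ENNReal.ofReal]
        rw [integral_withDensity_eq_integral_smul,
          integral_subtype_comap measurableSet_Ioi
            fun a : ℝ ↦ Real.toNNReal (a ^ 2) • f (a • (y : Space)),
          setIntegral_congr_fun measurableSet_Ioi fun x hx ↦ ?_]
        · rw [NNReal.smul_def, Real.coe_toNNReal _ (pow_nonneg hx.out.le _), smul_eq_mul]
        · exact (measurable_subtype_coe.pow_const _).real_toNNReal

lemma surfaceMeasure_real_univ : surfaceMeasure.real univ = 4 * Real.pi := by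
  rw [surfaceMeasure, toSphere_real_apply_univ, Measure.real, EuclideanSpace.volume_ball_fin_three]
  have : (0 : ℝ) ≤ Real.pi * 4 / 3 := by positivity
  simp [ENNReal.toReal_ofReal this]
  ring

/-! ### The forward light cone -/

/-- The parametrization `x ↦ (|x|, x)` of the forward light cone. -/
noncomputable def cone (x : Space) : SpaceTime := (‖x‖, x)

/-- The integral of `ψ` over the forward light cone with respect to `dx / |x|`. -/
noncomputable def coneIntegral (ψ : SpaceTime → ℝ) : ℝ := ∫ x : Space, ‖x‖⁻¹ * ψ (cone x)

/-- The standard basis of `ℝ³`. -/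
noncomputable def basisVec (k : Fin 3) : Space := EuclideanSpace.single k 1

lemma continuous_cone : Continuous cone := by unfold cone; fun_prop

lemma cone_smul {r : ℝ} (hr : 0 ≤ r) (x : Space) : cone (r • x) = r • cone x := by
  simp [cone, norm_smul, abs_of_nonneg hr]

lemma norm_cone (x : Space) : ‖cone x‖ = ‖x‖ := by
  simp [cone, Prod.norm_def]

lemma cone_ne_zero {x : Space} (hx : x ≠ 0) : cone x ≠ 0 := by
  rwa [← norm_ne_zero_iff, norm_cone, norm_ne_zero_iff]

lemma isClosedEmbedding_cone : IsClosedEmbedding cone :=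
  (Function.LeftInverse.isClosedEmbedding (f := Prod.snd) (fun _ => rfl) continuous_snd
    continuous_cone)

lemma hasCompactSupport_comp_cone {f : SpaceTime → ℝ} (hf : HasCompactSupport f) :
    HasCompactSupport fun x => f (cone x) :=
  hf.comp_isClosedEmbedding isClosedEmbedding_cone

lemma abs_coord_le_norm (x : Space) (k : Fin 3) : |x k| ≤ ‖x‖ := by
  simpa using PiLp.norm_apply_le x k

lemma sum_coord_sq (x : Space) : ∑ k, x k ^ 2 = ‖x‖ ^ 2 := by
  rw [EuclideanSpace.norm_sq_eq]
  simp

lemma hasFDerivAt_norm_space {x : Space} (hx : x ≠ 0) :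
    HasFDerivAt (fun y : Space => ‖y‖) (‖x‖⁻¹ • innerSL ℝ x) x := by
  have h0 : ‖x‖ ≠ 0 := norm_ne_zero_iff.2 hx
  have h := (hasStrictFDerivAt_norm_sq x).hasFDerivAt.sqrt (pow_ne_zero 2 h0)
  simp only [Real.sqrt_sq (norm_nonneg _)] at h
  convert! h using 1
  ext y
  simp
  field_simp

lemma hasFDerivAt_cone {x : Space} (hx : x ≠ 0) :
    HasFDerivAt cone ((‖x‖⁻¹ • innerSL ℝ x).prod (ContinuousLinearMap.id ℝ Space)) x :=
  (hasFDerivAt_norm_space hx).prodMk (hasFDerivAt_id x)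

lemma hasLineDerivAt_norm {x : Space} (hx : x ≠ 0) (k : Fin 3) :
    HasLineDerivAt ℝ (fun y : Space => ‖y‖) (x k / ‖x‖) x (basisVec k) := by
  have h := (hasFDerivAt_norm_space hx).hasLineDerivAt (basisVec k)
  convert! h using 1
  simp [basisVec, EuclideanSpace.inner_single_right]
  ring

lemma hasLineDerivAt_comp_cone {f : SpaceTime → ℝ} {x : Space} (hx : x ≠ 0)
    (hf : DifferentiableAt ℝ f (cone x)) (k : Fin 3) :
    HasLineDerivAt ℝ (fun y => f (cone y))
      (x k / ‖x‖ * fderiv ℝ f (cone x) (dir 0) + fderiv ℝ f (cone x) (dir k.succ)) x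
      (basisVec k) := by
  have h := (hf.hasFDerivAt.comp x (hasFDerivAt_cone hx)).hasLineDerivAt (basisVec k)
  convert! h using 1
  rw [← smul_eq_mul, ← map_smul, ← map_add]
  simp only [ContinuousLinearMap.comp_apply]
  congr 1
  ext i
  · simp [dir_zero, dir_succ, basisVec, EuclideanSpace.inner_single_right]
    ring
  · simp [dir_zero, dir_succ, basisVec]

lemma hasLineDerivAt_coord (x : Space) (k : Fin 3) :
    HasLineDerivAt ℝ (fun y : Space => y k) 1 x (basisVec k) := by
  have h := ((EuclideanSpace.proj k : Space →L[ℝ] ℝ).hasFDerivAt (x := x)).hasLineDerivAt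
    (basisVec k)
  convert! h using 1
  simp [basisVec]

lemma basisVec_ne_zero (k : Fin 3) : basisVec k ≠ 0 := by simp [basisVec]

/-! ### Integrability of singular weights on the cone -/

lemma integrable_weight_mul_cone {w : Space → ℝ} (hw : Measurable w) {b : ℕ} (hb : b < 3)
    (hwb : ∀ x, |w x| ≤ (‖x‖⁻¹) ^ b) {f : SpaceTime → ℝ} (hf : Continuous f)
    (hc : HasCompactSupport f) : Integrable fun x => w x * f (cone x) := by
  obtain ⟨C, hC⟩ := hf.bounded_above_of_compact_support hc
  have hli : LocallyIntegrable w :=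
    locallyIntegrable_of_norm_le_rpow (C := 1) (α := b) (by simp [Space])
      (by simp [Space]; exact_mod_cast hb) (ae_of_all _ fun x => by
        rw [one_mul, Real.rpow_neg (norm_nonneg _), Real.rpow_natCast, ← inv_pow]
        exact hwb x) hw.aestronglyMeasurable
  have h := hli.integrable_smul_right_of_hasCompactSupport (hf.comp continuous_cone)
    (hasCompactSupport_comp_cone hc)
  exact h

/-- The weight `(xₖ / |x|)ᵃ |x|⁻ᵇ`. -/
noncomputable def weight (k : Fin 3) (a b : ℕ) (x : Space) : ℝ := (x k / ‖x‖) ^ a * (‖x‖⁻¹) ^ b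

lemma measurable_weight (k : Fin 3) (a b : ℕ) : Measurable (weight k a b) := by
  unfold weight
  fun_prop

lemma abs_weight_le (k : Fin 3) (a b : ℕ) (x : Space) : |weight k a b x| ≤ (‖x‖⁻¹) ^ b := by
  rw [weight, abs_mul, abs_of_nonneg (pow_nonneg (inv_nonneg.2 (norm_nonneg x)) b), abs_pow]
  refine mul_le_of_le_one_left (by positivity) (pow_le_one₀ (abs_nonneg _) ?_)
  rw [abs_div, abs_norm]
  exact div_le_one_of_le₀ (abs_coord_le_norm x k) (norm_nonneg _)

lemma integrable_weight (k : Fin 3) (a : ℕ) {b : ℕ} (hb : b < 3) (φ : Test) :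
    Integrable fun x => weight k a b x * φ (cone x) :=
  integrable_weight_mul_cone (measurable_weight k a b) hb (abs_weight_le k a b) φ.continuous
    φ.hasCompactSupport

lemma integrable_inv_norm_mul_cone {f : SpaceTime → ℝ} (hf : Continuous f)
    (hc : HasCompactSupport f) : Integrable fun x => ‖x‖⁻¹ * f (cone x) :=
  integrable_weight_mul_cone (b := 1) (by fun_prop) (by norm_num) (fun x => by simp) hf hc

/-! ### The wave operator on the cone -/

/-- The wave operator on test functions. -/
noncomputable def boxTest (φ : Test) : Test :=
  ∂_{dir 0} (∂_{dir 0} φ) - ∑ j : Fin 3, ∂_{dir j.succ} (∂_{dir j.succ} φ)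

lemma two_le_infty : (2 : WithTop ℕ∞) ≤ ∞ := WithTop.coe_le_coe.2 le_top

lemma lineDeriv_test_comm (φ : Test) (a b : SpaceTime) : ∂_{a} (∂_{b} φ) = ∂_{b} (∂_{a} φ) := by
  have key : ∀ a b z, (∂_{a} (∂_{b} φ)) z = fderiv ℝ (fderiv ℝ φ) z a b := by
    intro a b z
    rw [lineDeriv_test_apply]
    have h1 : (⇑(∂_{b} φ : Test) : SpaceTime → ℝ) = fun y => fderiv ℝ φ y b := by
      ext y
      rw [lineDeriv_test_apply]
    have h2 : DifferentiableAt ℝ (fderiv ℝ φ) z :=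
      (φ.contDiff.fderiv_right (m := 1) (by rw [one_add_one_eq_two]; exact two_le_infty)).differentiable (by simp) z
    rw [h1, fderiv_clm_apply h2 (differentiableAt_const b)]
    simp
  ext z
  rw [key, key]
  exact (φ.contDiff.contDiffAt.isSymmSndFDerivAt (by simpa using two_le_infty)) a b

lemma boxTest_apply (φ : Test) (z : SpaceTime) :
    boxTest φ z = (∂_{dir 0} (∂_{dir 0} φ)) z - ∑ j : Fin 3, (∂_{dir j.succ} (∂_{dir j.succ} φ)) z := by
  simp [boxTest]

lemma box_apply (F : Dist) (φ : Test) : box F φ = F (boxTest φ) := by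
  have h : ∀ w : SpaceTime, (∂_{w} (∂_{w} F) : Dist) φ = F (∂_{w} (∂_{w} φ)) := by
    intro w
    rw [lineDeriv_dist_apply, lineDeriv_dist_apply, neg_neg]
  simp only [box, partialD, boxTest, map_sub, _root_.map_sum, ← h]
  simp [Fin.sum_univ_three]

/-- The `k`-th term of the divergence on `ℝ³` of the field with components
`xₖ |x|⁻² ∂ₜφ - |x|⁻¹ ∂ₖφ`, where the derivatives of `φ` are taken on the cone. -/
noncomputable def divergenceTerm (φ : Test) (k : Fin 3) (x : Space) : ℝ :=
  weight k 0 2 x * (∂_{dir 0} φ) (cone x) - 2 * (weight k 2 2 x * (∂_{dir 0} φ) (cone x))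
    + weight k 2 1 x * (∂_{dir 0} (∂_{dir 0} φ)) (cone x)
    + weight k 1 2 x * (∂_{dir k.succ} φ) (cone x)
    - weight k 0 1 x * (∂_{dir k.succ} (∂_{dir k.succ} φ)) (cone x)

lemma integrable_divergenceTerm (φ : Test) (k : Fin 3) : Integrable (divergenceTerm φ k) :=
  ((((integrable_weight k 0 (by norm_num) _).sub
    ((integrable_weight k 2 (by norm_num) _).const_mul 2)).add
    (integrable_weight k 2 (by norm_num) _)).add (integrable_weight k 1 (by norm_num) _)).sub
    (integrable_weight k 0 (by norm_num) _)

/-- The field component is `O(|x|⁻¹)` and its derivative `O(|x|⁻²)` near `0`; both are integrable in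
dimension three, so the vertex contributes nothing. The mixed derivatives `∂ₜ∂ₖφ` cancel. -/
lemma integral_divergenceTerm (φ : Test) (k : Fin 3) : ∫ x, divergenceTerm φ k x = 0 := by
  refine integral_eq_zero_of_hasLineDerivAt (by simp [Space]) (basisVec_ne_zero k)
    (f := fun x => weight k 1 1 x * (∂_{dir 0} φ) (cone x)
      - weight k 0 1 x * (∂_{dir k.succ} φ) (cone x))
    ((integrable_weight k 1 (by norm_num) _).sub (integrable_weight k 0 (by norm_num) _))
    (integrable_divergenceTerm φ k) ?_
  intro x hx
  have h0 : ‖x‖ ≠ 0 := norm_ne_zero_iff.2 hx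
  have hp := hasLineDerivAt_comp_cone hx (differentiable_test (∂_{dir 0} φ) _) k
  have hq := hasLineDerivAt_comp_cone hx (differentiable_test (∂_{dir k.succ} φ) _) k
  simp only [← lineDeriv_test_apply] at hp hq
  rw [lineDeriv_test_comm φ (dir k.succ) (dir 0)] at hp
  have hn := hasLineDerivAt_norm hx k
  have hx' := hasLineDerivAt_coord x k
  simp only [divergenceTerm, weight, pow_zero, pow_one, one_mul]
  unfold HasLineDerivAt at *
  have hn0 : ‖x + (0 : ℝ) • basisVec k‖ ≠ 0 := by simpa using h0
  have H := (((hx'.div hn hn0).mul (hn.inv hn0)).mul hp).sub ((hn.inv hn0).mul hq)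
  convert! H using 1
  simp only [zero_smul, add_zero, Pi.div_apply, Pi.mul_apply, Pi.inv_apply]
  field_simp
  ring

lemma ae_ne_zero : ∀ᵐ x : Space, x ≠ 0 :=
  measure_eq_zero_iff_ae_notMem.1 (measure_singleton 0)

lemma fderiv_test_cone (φ : Test) (x : Space) : fderiv ℝ φ (cone x) (1, ‖x‖⁻¹ • x)
    = (∂_{dir 0} φ) (cone x) + ∑ k : Fin 3, (x k / ‖x‖) * (∂_{dir k.succ} φ) (cone x) := by
  simp only [lineDeriv_test_apply, ← smul_eq_mul, ← map_smul, ← _root_.map_sum, ← map_add]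
  congr 1
  simp only [dir_zero, dir_succ, Fin.sum_univ_three]
  ext j
  · simp
  · fin_cases j <;> simp [div_eq_inv_mul]

lemma integrable_radial_derivative (φ : Test) :
    Integrable fun x : Space => (‖x‖ ^ 2)⁻¹ * fderiv ℝ φ (cone x) (1, ‖x‖⁻¹ • x) := by
  have h : (fun x : Space => (‖x‖ ^ 2)⁻¹ * fderiv ℝ φ (cone x) (1, ‖x‖⁻¹ • x)) =
      fun x => weight 0 0 2 x * (∂_{dir 0} φ) (cone x)
        + ∑ k : Fin 3, weight k 1 2 x * (∂_{dir k.succ} φ) (cone x) := by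
    ext x
    rw [fderiv_test_cone, mul_add, Finset.mul_sum]
    simp only [weight, pow_zero, pow_one, one_mul, inv_pow]
    congr 1
    exact Finset.sum_congr rfl fun k _ => by ring
  rw [h]
  exact (integrable_weight 0 0 (by norm_num) _).add
    (integrable_finsetSum _ fun k _ => integrable_weight k 1 (by norm_num) _)

/-- With `∑ xₖ² = |x|²`, the divergence sums to `|x|⁻¹ □φ + |x|⁻² (∂ₜ + (x/|x|)·∇)φ`: the
coefficient of `|x|⁻² ∂ₜφ` is `3 - 2 = 1`. -/
lemma coneIntegral_boxTest_eq (φ : Test) :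
    coneIntegral (boxTest φ) = -∫ x, (‖x‖ ^ 2)⁻¹ * fderiv ℝ φ (cone x) (1, ‖x‖⁻¹ • x) := by
  have hsum : ∑ k : Fin 3, ∫ x, divergenceTerm φ k x = 0 :=
    Finset.sum_eq_zero fun k _ => integral_divergenceTerm φ k
  rw [← integral_finsetSum _ fun k _ => integrable_divergenceTerm φ k] at hsum
  rw [eq_neg_iff_add_eq_zero, coneIntegral, ← integral_add
    (integrable_inv_norm_mul_cone (boxTest φ).continuous (boxTest φ).hasCompactSupport)
    (integrable_radial_derivative φ), ← hsum]
  refine integral_congr_ae ?_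
  filter_upwards [ae_ne_zero] with x hx
  have h0 : ‖x‖ ≠ 0 := norm_ne_zero_iff.2 hx
  have hs := sum_coord_sq x
  rw [fderiv_test_cone, boxTest_apply]
  simp only [Fin.sum_univ_three] at hs ⊢
  simp only [divergenceTerm, weight, pow_zero, pow_one, one_mul]
  have hs' : (x 0 / ‖x‖) ^ 2 + (x 1 / ‖x‖) ^ 2 + (x 2 / ‖x‖) ^ 2 = 1 := by
    field_simp
    exact hs
  have hs2 : (x 2 / ‖x‖) ^ 2 = 1 - (x 0 / ‖x‖) ^ 2 - (x 1 / ‖x‖) ^ 2 := by linarith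
  rw [hs2, inv_pow]
  ring

/-- The measure `dx / (4π|x|)` on the forward light cone is a fundamental solution. -/
lemma coneIntegral_boxTest (φ : Test) : coneIntegral (boxTest φ) = 4 * Real.pi * φ 0 := by
  rw [coneIntegral_boxTest_eq, integral_polar (integrable_radial_derivative φ)]
  have h1 : ∀ y : Metric.sphere (0 : Space) 1, ∫ r in Ioi (0 : ℝ), r ^ 2 *
      ((‖r • (y : Space)‖ ^ 2)⁻¹ * fderiv ℝ φ (cone (r • (y : Space)))
        (1, ‖r • (y : Space)‖⁻¹ • r • (y : Space))) = -φ 0 := by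
    intro y
    have hy : ‖(y : Space)‖ = 1 := mem_sphere_zero_iff_norm.1 y.2
    -- The Jacobian `r²` cancels the weight, and what remains on each ray is the exact derivative of
    -- `r ↦ φ(r (1, y))`.
    have h2 : ∫ r in Ioi (0 : ℝ), fderiv ℝ φ (r • cone y) (cone y) = 0 - φ ((0 : ℝ) • cone y) := by
      have hd : ∀ r : ℝ, HasDerivAt (fun r : ℝ => φ (r • cone y))
          (fderiv ℝ φ (r • cone y) (cone y)) r := by
        intro r
        have := (differentiable_test φ (r • cone y)).hasFDerivAt.comp_hasDerivAt r
          ((hasDerivAt_id r).smul_const (cone y))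
        simpa [Function.comp_def] using this
      have hemb : IsClosedEmbedding fun r : ℝ => r • cone (y : Space) :=
        isClosedEmbedding_smul_left (cone_ne_zero fun h => by simp [h] at hy)
      have hcs : HasCompactSupport fun r : ℝ => φ (r • cone y) :=
        φ.hasCompactSupport.comp_isClosedEmbedding hemb
      have hcs' : HasCompactSupport fun r : ℝ => fderiv ℝ φ (r • cone y) (cone y) :=
        (φ.hasCompactSupport.fderiv_apply ℝ (cone y)).comp_isClosedEmbedding hemb
      refine integral_Ioi_of_hasDerivAt_of_tendsto (f := fun r : ℝ => φ (r • cone y))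
        (hd 0).continuousAt.continuousWithinAt (fun r _ => hd r) ?_ ?_
      · refine (Continuous.integrable_of_hasCompactSupport ?_ hcs').integrableOn
        have := φ.contDiff.continuous_fderiv (by simp)
        fun_prop
      · refine tendsto_const_nhds.congr' ?_
        have := hcs.isCompact.bddAbove
        obtain ⟨B, hB⟩ := this
        filter_upwards [eventually_gt_atTop B] with r hr
        by_contra hne
        exact absurd (hB (subset_tsupport _ (Ne.symm hne))) (not_le.2 hr)
    rw [zero_smul, zero_sub] at h2
    rw [← h2]
    refine setIntegral_congr_fun measurableSet_Ioi fun r hr => ?_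
    have hr0 : (0 : ℝ) < r := hr
    simp only [cone_smul hr0.le, norm_smul, hy, Real.norm_of_nonneg hr0.le, mul_one, smul_smul]
    rw [inv_mul_cancel₀ hr0.ne', one_smul, ← mul_assoc, mul_inv_cancel₀ (pow_ne_zero 2 hr0.ne'),
      one_mul]
    simp [cone, hy]
  rw [integral_congr_ae (ae_of_all _ h1), integral_const, surfaceMeasure_real_univ]
  simp

/-! ### The backward potential of a test function -/

/-- The potential `z ↦ ∫ φ(z + (|y|, y)) dy / |y|`. -/
noncomputable def potential (φ : SpaceTime → ℝ) (z : SpaceTime) : ℝ :=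
  coneIntegral fun y => φ (z + y)

/-- The image of Lebesgue measure on the backward light cone. -/
noncomputable def backwardMeasure : Measure SpaceTime :=
  (volume : Measure Space).map fun y => -cone y

lemma isClosedEmbedding_neg_cone : IsClosedEmbedding fun y => -cone y :=
  (Homeomorph.neg SpaceTime).isClosedEmbedding.comp isClosedEmbedding_cone

lemma locallyIntegrable_map {g : Space → SpaceTime} (hg : IsClosedEmbedding g) {f : SpaceTime → ℝ}
    (hf : LocallyIntegrable fun x => f (g x)) :
    LocallyIntegrable f ((volume : Measure Space).map g) := by
  rw [locallyIntegrable_iff]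
  intro K hK
  rw [hg.measurableEmbedding.integrableOn_map_iff]
  exact hf.integrableOn_isCompact (hg.isCompact_preimage hK)

lemma locallyIntegrable_inv_norm : LocallyIntegrable fun x : Space => ‖x‖⁻¹ :=
  locallyIntegrable_of_norm_le_rpow (C := 1) (α := 1) (by simp [Space])
    (by simp [Space]) (ae_of_all _ fun x => by
      rw [one_mul, Real.rpow_neg (norm_nonneg _), Real.rpow_one, norm_inv, norm_norm])
    (by fun_prop)

lemma locallyIntegrable_backward :
    LocallyIntegrable (fun t : SpaceTime => ‖t.2‖⁻¹) backwardMeasure := by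
  refine locallyIntegrable_map isClosedEmbedding_neg_cone ?_
  simpa [cone] using locallyIntegrable_inv_norm

/-- Viewing the potential as a convolution against a measure carried by the backward cone, with a
locally integrable kernel, makes smoothness and differentiation under the integral available. -/
lemma potential_eq_convolution (φ : SpaceTime → ℝ) : potential φ =
    convolution (fun t : SpaceTime => ‖t.2‖⁻¹) φ (ContinuousLinearMap.lsmul ℝ ℝ)
      backwardMeasure := by
  ext z
  rw [convolution_def, backwardMeasure, isClosedEmbedding_neg_cone.integral_map]
  refine integral_congr_ae (ae_of_all _ fun y => ?_)
  change ‖y‖⁻¹ * φ (z + cone y) = ‖-y‖⁻¹ * φ (z - -cone y)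
  rw [norm_neg, sub_neg_eq_add]

lemma contDiff_potential (φ : Test) : ContDiff ℝ ∞ (potential φ) := by
  rw [potential_eq_convolution]
  exact φ.hasCompactSupport.contDiff_convolution_right _ locallyIntegrable_backward φ.contDiff

lemma fderiv_potential (φ : Test) (z w : SpaceTime) :
    fderiv ℝ (potential φ) z w = potential (∂_{w} φ : Test) z := by
  have hφ1 : ContDiff ℝ 1 φ := φ.contDiff.of_le (by simp)
  -- The real parameter is a dummy; the derivative in `z` is recovered by restricting to the second
  -- factor.
  let g : ℝ → SpaceTime → ℝ := fun _ => φ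
  have hg : (↿g : ℝ × SpaceTime → ℝ) = fun q => φ q.2 := rfl
  have hd : ∀ q : ℝ × SpaceTime, HasFDerivAt (↿g : ℝ × SpaceTime → ℝ)
      ((fderiv ℝ φ q.2).comp (ContinuousLinearMap.snd ℝ ℝ SpaceTime)) q := fun q =>
    (differentiable_test φ q.2).hasFDerivAt.comp q hasFDerivAt_snd
  have h := hasFDerivAt_convolution_right_with_param (ContinuousLinearMap.lsmul ℝ ℝ) (g := g)
    isOpen_univ φ.hasCompactSupport.isCompact
    (fun p x _ hx => image_eq_zero_of_notMem_tsupport hx) locallyIntegrable_backward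
    (by rw [hg]; exact (hφ1.comp contDiff_snd).contDiffOn) (0, z) (mem_univ _)
  have h2 := h.comp z (hasFDerivAt_prodMk_right (𝕜 := ℝ) (0 : ℝ) z)
  have h3 : (fun q : ℝ × SpaceTime => convolution (fun t : SpaceTime => ‖t.2‖⁻¹) (g q.1)
      (ContinuousLinearMap.lsmul ℝ ℝ) backwardMeasure q.2) ∘ (fun x => ((0 : ℝ), x)) =
      potential φ := by
    rw [potential_eq_convolution]
    rfl
  rw [h3] at h2
  rw [h2.fderiv, potential_eq_convolution]
  simp only [ContinuousLinearMap.comp_apply, ContinuousLinearMap.inr_apply]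
  have hcs : HasCompactSupport fun x : SpaceTime => fderiv ℝ (↿g) ((0 : ℝ), x) := by
    refine φ.hasCompactSupport.mono' fun x hx => ?_
    by_contra hx'
    apply hx
    change fderiv ℝ (↿g) ((0 : ℝ), x) = 0
    rw [(hd (0, x)).fderiv, image_eq_zero_of_notMem_tsupport
      (fun hh => hx' (tsupport_fderiv_subset ℝ hh)), ContinuousLinearMap.zero_comp]
  have hcont : Continuous fun x : SpaceTime => fderiv ℝ (↿g) ((0 : ℝ), x) := by
    have : (fun x : SpaceTime => fderiv ℝ (↿g) ((0 : ℝ), x)) = fun x =>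
        (fderiv ℝ φ x).comp (ContinuousLinearMap.snd ℝ ℝ SpaceTime) :=
      funext fun x => (hd (0, x)).fderiv
    rw [this]
    have := φ.contDiff.continuous_fderiv (by simp)
    fun_prop
  have hex := hcs.convolutionExists_right
    (ContinuousLinearMap.precompR (ℝ × SpaceTime) (ContinuousLinearMap.lsmul ℝ ℝ))
    locallyIntegrable_backward hcont z
  rw [convolution_def, convolution_def, ContinuousLinearMap.integral_apply hex]
  refine integral_congr_ae (ae_of_all _ fun t => ?_)
  simp only [ContinuousLinearMap.precompR_apply]
  rw [(hd _).fderiv, lineDeriv_test_apply]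
  rfl

/-- The translate `y ↦ φ(z + y)` of a test function. -/
noncomputable def translate (z : SpaceTime) (φ : Test) : Test :=
  mkTest (fun y => φ (z + y)) (φ.contDiff.comp (contDiff_const.add contDiff_id))
    (φ.hasCompactSupport.comp_homeomorph (Homeomorph.addLeft z))

lemma lineDeriv_translate (z w : SpaceTime) (φ : Test) :
    ∂_{w} (translate z φ) = translate z (∂_{w} φ) := by
  ext y
  change _ = (∂_{w} φ) (z + y)
  rw [lineDeriv_test_apply, lineDeriv_test_apply]
  change fderiv ℝ (fun y => φ (z + y)) y w = _
  rw [fderiv_comp_add_left]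

lemma potential_boxTest (φ : Test) (z : SpaceTime) :
    potential (boxTest φ) z = 4 * Real.pi * φ z := by
  have h := coneIntegral_boxTest (translate z φ)
  have h1 : boxTest (translate z φ) = translate z (boxTest φ) := by
    ext y
    change _ = (boxTest φ) (z + y)
    simp only [boxTest_apply, lineDeriv_translate]
    rfl
  rw [h1] at h
  convert! h using 2
  change φ z = φ (z + 0)
  rw [add_zero]

lemma lineDeriv_eq_potential {U : Set SpaceTime} (hU : IsOpen U) {θ φ : Test}
    (h : ∀ z ∈ U, θ z = potential φ z) (w : SpaceTime) :
    ∀ z ∈ U, (∂_{w} θ) z = potential (∂_{w} φ : Test) z := by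
  intro z hz
  rw [lineDeriv_test_apply, ← fderiv_potential]
  have : (θ : SpaceTime → ℝ) =ᶠ[𝓝 z] potential φ := by
    filter_upwards [hU.mem_nhds hz] with y hy using h y hy
  rw [this.fderiv_eq]

lemma integrable_inv_norm_mul_translate (φ : Test) (z : SpaceTime) :
    Integrable fun x => ‖x‖⁻¹ * φ (z + cone x) :=
  integrable_inv_norm_mul_cone (translate z φ).continuous (translate z φ).hasCompactSupport

lemma potential_boxTest_eq (φ : Test) (z : SpaceTime) :
    potential (boxTest φ) z = potential (∂_{dir 0} (∂_{dir 0} φ) : Test) z -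
      ∑ j : Fin 3, potential (∂_{dir j.succ} (∂_{dir j.succ} φ) : Test) z := by
  simp only [potential, coneIntegral, boxTest_apply, mul_sub, Finset.mul_sum]
  rw [integral_sub (integrable_inv_norm_mul_translate _ z)
    (integrable_finsetSum _ fun k _ => integrable_inv_norm_mul_translate _ z),
    integral_finsetSum _ fun k _ => integrable_inv_norm_mul_translate _ z]

/-- The forward fundamental solution is the measure `dx / (4π|x|)` on the forward light cone. -/
theorem IsForwardFundamentalSolution.apply_eq {Y : Dist} (hY : IsForwardFundamentalSolution Y)
    (φ : Test) : Y φ = (4 * Real.pi)⁻¹ * coneIntegral φ := by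
  obtain ⟨R, hR0, hR⟩ := φ.hasCompactSupport.isCompact.isBounded.exists_pos_norm_le
  have hφ0 : ∀ z, R < ‖z‖ → φ z = 0 := fun z hz =>
    image_eq_zero_of_notMem_tsupport fun h => absurd (hR z h) (not_le.2 hz)
  -- The potential vanishes for `t > R`, and `|x| ≤ t ≤ R` is bounded. Cutting it off outside a
  -- large ball therefore changes nothing on the neighbourhood `U` of `supp Y`, and `Y (□ θ) = θ 0`
  -- can be evaluated.
  let χ : ContDiffBump (0 : SpaceTime) := ⟨R + 1, R + 2, by linarith, by linarith⟩
  let θ : Test := mkTest (fun z => χ z * potential φ z) (χ.contDiff.mul (contDiff_potential φ))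
    χ.hasCompactSupport.mul_right
  let U : Set SpaceTime := {z | R < z.1} ∪ Metric.ball 0 (R + 1)
  have hU : IsOpen U := (isOpen_lt continuous_const continuous_fst).union Metric.isOpen_ball
  have hθ : ∀ z ∈ U, θ z = potential φ z := by
    rintro z (hz | hz)
    · have h0 : potential φ z = 0 := by
        refine integral_eq_zero_of_ae (ae_of_all _ fun y => ?_)
        change ‖y‖⁻¹ * φ (z + cone y) = 0
        rw [hφ0, mul_zero]
        · refine lt_of_lt_of_le ?_ (norm_fst_le _)
          refine lt_of_lt_of_le ?_ (le_abs_self _)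
          have : 0 ≤ ‖y‖ := norm_nonneg y
          change R < z.1 + ‖y‖
          have : R < z.1 := hz
          linarith
      simp [θ, h0]
    · have : χ z = 1 := χ.one_of_mem_closedBall (Metric.ball_subset_closedBall hz)
      simp [θ, this]
  have hbox : ∀ z ∈ U, boxTest θ z = 4 * Real.pi * φ z := by
    intro z hz
    have h2 : ∀ w, (∂_{w} (∂_{w} θ) : Test) z = potential (∂_{w} (∂_{w} φ) : Test) z := fun w =>
      lineDeriv_eq_potential hU (lineDeriv_eq_potential hU hθ w) w z hz
    rw [← potential_boxTest, potential_boxTest_eq, boxTest_apply]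
    simp only [h2]
  have hcone : Distribution.dsupport Y ⊆ U := by
    intro z hz
    have h1 : ‖z.2‖ ≤ z.1 := hY.2 hz
    rcases lt_or_ge R z.1 with h | h
    · exact Or.inl h
    · refine Or.inr ?_
      rw [mem_ball_zero_iff, Prod.norm_def]
      have : ‖z.1‖ ≤ R := by
        rw [Real.norm_of_nonneg ((norm_nonneg _).trans h1)]
        exact h
      exact (max_le this (h1.trans h)).trans_lt (by linarith)
  have hv : Y (boxTest θ - (4 * Real.pi) • φ) = 0 := by
    refine isVanishingOn_compl_dsupport Y _ ?_
    have : tsupport (boxTest θ - (4 * Real.pi) • φ : Test) ⊆ Uᶜ := by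
      refine closure_minimal (fun z hz hzU => hz ?_) hU.isClosed_compl
      change boxTest θ z - (4 * Real.pi) * φ z = 0
      rw [hbox z hzU, sub_self]
    exact this.trans (compl_subset_compl.2 hcone)
  have h4 : Y (boxTest θ) = coneIntegral φ := by
    rw [← box_apply, hY.1, Distribution.delta_apply]
    rw [hθ 0 (Or.inr (Metric.mem_ball_self (by linarith)))]
    simp [potential]
  rw [map_sub, map_smul, h4, sub_eq_zero, smul_eq_mul] at hv
  rw [hv, inv_mul_cancel_left₀ (by positivity)]

/-! ### Homogeneous extensions of products -/

lemma HomogeneousFunction.exists_bound {k : ℤ} (a : HomogeneousFunction k) :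
    ∃ C : ℝ, ∀ x : Space, x ≠ 0 → |a (cone x)| ≤ C * ‖x‖ ^ k := by
  have hK : IsCompact (cone '' Metric.sphere (0 : Space) 1) :=
    (isCompact_sphere 0 1).image continuous_cone
  have hsub : cone '' Metric.sphere (0 : Space) 1 ⊆ {0}ᶜ := by
    rintro _ ⟨x, hx, rfl⟩
    refine cone_ne_zero fun h => ?_
    simp [h] at hx
  obtain ⟨C, hC⟩ := hK.exists_bound_of_continuousOn (a.smooth.continuousOn.mono hsub)
  refine ⟨C, fun x hx => ?_⟩
  have h0 : 0 < ‖x‖ := norm_pos_iff.2 hx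
  have hy : ‖x‖⁻¹ • x ≠ 0 := smul_ne_zero (inv_ne_zero h0.ne') hx
  have hyn : ‖‖x‖⁻¹ • x‖ = 1 := by
    rw [norm_smul, norm_inv, norm_norm, inv_mul_cancel₀ h0.ne']
  have hx' : cone x = ‖x‖ • cone (‖x‖⁻¹ • x) := by
    rw [← cone_smul h0.le, smul_smul, mul_inv_cancel₀ h0.ne', one_smul]
  rw [hx', a.homogeneous _ _ h0 (cone_ne_zero hy), abs_mul, abs_of_pos (zpow_pos h0 k), mul_comm C]
  exact mul_le_mul_of_nonneg_left
    (hC _ ⟨_, mem_sphere_zero_iff_norm.2 hyn, rfl⟩) (zpow_pos h0 k).le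

lemma HomogeneousFunction.aestronglyMeasurable_cone {k : ℤ} (a : HomogeneousFunction k) :
    AEStronglyMeasurable (fun x : Space => a (cone x)) := by
  have h : ContinuousOn (fun x : Space => a (cone x)) {0}ᶜ :=
    a.smooth.continuousOn.comp continuous_cone.continuousOn fun x hx => cone_ne_zero hx
  have h2 := h.aestronglyMeasurable (μ := volume) (measurableSet_singleton (0 : Space)).compl
  rwa [restrict_compl_singleton] at h2

/-- The density is `O(|x| ^ (k - 1))`, and `1 - k < 3` in dimension three means `k > -2`. The
coefficients `bᵢⱼ²`, with `k = -2`, are just outside this range. -/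
lemma HomogeneousFunction.locallyIntegrable_cone {k : ℤ} (hk : -2 < k)
    (a : HomogeneousFunction k) : LocallyIntegrable fun x : Space => ‖x‖⁻¹ * a (cone x) := by
  obtain ⟨C, hC⟩ := a.exists_bound
  refine locallyIntegrable_of_norm_le_rpow (C := C) (α := ((1 - k : ℤ) : ℝ)) (by simp [Space]) ?_ ?_ ?_
  · have : Module.finrank ℝ Space = 3 := by simp [Space]
    rw [this]
    exact_mod_cast (by omega : 1 - k < 3)
  · filter_upwards [ae_ne_zero] with x hx
    have h0 : 0 < ‖x‖ := norm_pos_iff.2 hx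
    rw [← Int.cast_neg, Real.rpow_intCast, norm_mul, norm_inv, norm_norm,
      show -(1 - k) = -1 + k by ring, zpow_add₀ h0.ne', zpow_neg_one]
    calc ‖x‖⁻¹ * ‖a (cone x)‖ ≤ ‖x‖⁻¹ * (C * ‖x‖ ^ k) :=
          mul_le_mul_of_nonneg_left (hC x hx) (inv_nonneg.2 h0.le)
      _ = _ := by ring
  · have : AEStronglyMeasurable fun x : Space => ‖x‖⁻¹ :=
      (by fun_prop : Measurable fun x : Space => ‖x‖⁻¹).aestronglyMeasurable
    exact this.mul a.aestronglyMeasurable_cone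

/-- In the substitution `x ↦ c x` the exponent is `3` from the Jacobian, `-1` from the weight and
`k` from `a`. -/
lemma coneIntegral_dilate {k : ℤ} (a : HomogeneousFunction k) {c : ℝ} (hc : 0 < c)
    (φ : SpaceTime → ℝ) : coneIntegral (fun z => a z * φ (c⁻¹ • z)) =
      c ^ (k + 2) * coneIntegral (fun z => a z * φ z) := by
  have h := integral_comp_smul (volume : Measure Space)
    (fun x : Space => ‖x‖⁻¹ * (a (cone x) * φ (c⁻¹ • cone x))) c
  have h3 : Module.finrank ℝ Space = 3 := by simp [Space]
  have h2 : ∫ x : Space, ‖c • x‖⁻¹ * (a (cone (c • x)) * φ (c⁻¹ • cone (c • x))) =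
      ∫ x : Space, (c⁻¹ * c ^ k) * (‖x‖⁻¹ * (a (cone x) * φ (cone x))) := by
    refine integral_congr_ae ?_
    filter_upwards [ae_ne_zero] with x hx
    rw [cone_smul hc.le, a.homogeneous c _ hc (cone_ne_zero hx), smul_smul, inv_mul_cancel₀ hc.ne',
      one_smul, norm_smul, Real.norm_of_nonneg hc.le, mul_inv]
    ring
  rw [h2, integral_const_mul, h3, abs_of_pos (by positivity), smul_eq_mul] at h
  simp only [coneIntegral]
  have hc3 : c ^ 3 ≠ 0 := by positivity
  have h4 := congrArg (fun t => c ^ 3 * t) h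
  simp only [mul_inv_cancel_left₀ hc3] at h4
  rw [← h4, zpow_add₀ hc.ne']
  field_simp

/-- The product `a Y` of `Y` with a function homogeneous of degree `k > -2` is given by a locally
integrable density on the cone, and so defines a homogeneous distribution of degree `k - 2`. -/
lemma exists_isHomogeneousExtension {Y : Dist} (hY : IsForwardFundamentalSolution Y) {k m : ℤ}
    (hk : -2 < k) (hm : k - 2 = m) (a : HomogeneousFunction k) :
    ∃ F : Dist, IsHomogeneousExtension m a Y F ∧
      ∀ φ : Test, F φ = (4 * Real.pi)⁻¹ * coneIntegral fun z => a z * φ z := by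
  let f : SpaceTime → ℝ := fun z => (4 * Real.pi)⁻¹ * (‖z.2‖⁻¹ * a z)
  have hf : LocallyIntegrable f ((volume : Measure Space).map cone) :=
    locallyIntegrable_map isClosedEmbedding_cone ((a.locallyIntegrable_cone hk).smul
      (4 * Real.pi)⁻¹)
  let L : Test →L[ℝ] ℝ := TestFunction.integralAgainstBilinCLM (ContinuousLinearMap.mul ℝ ℝ)
    ((volume : Measure Space).map cone) f
  let F : Dist := ⟨L.toLinearMap, L.continuous⟩
  have hF : ∀ φ : Test, F φ = (4 * Real.pi)⁻¹ * coneIntegral fun z => a z * φ z := by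
    intro φ
    change TestFunction.integralAgainstBilinCLM _ _ _ φ = _
    rw [TestFunction.integralAgainstBilinCLM_eq_integral (hf.locallyIntegrableOn _),
      isClosedEmbedding_cone.measurableEmbedding.integral_map, coneIntegral, ← integral_const_mul]
    refine integral_congr_ae (ae_of_all _ fun x => ?_)
    change φ (cone x) * ((4 * Real.pi)⁻¹ * (‖x‖⁻¹ * a (cone x))) = _
    ring
  refine ⟨F, ⟨fun c hc φ => ?_, fun φ => ?_⟩, hF⟩
  · rw [hF, hF]
    simp only [dilate_apply]
    rw [coneIntegral_dilate a hc, ← hm, show k - 2 + 4 = k + 2 by ring]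
    ring
  · rw [hF, hY.apply_eq]
    rfl

lemma IsForwardFundamentalSolution.isHomogeneous {Y : Dist} (hY : IsForwardFundamentalSolution Y) :
    IsHomogeneous (-2) Y := by
  let a : HomogeneousFunction 0 := ⟨fun _ => 1, contDiffOn_const, fun _ _ _ _ => by simp⟩
  obtain ⟨F, hF, h⟩ := exists_isHomogeneousExtension hY (k := 0) (m := -2) (by norm_num)
    (by norm_num) a
  have : Y = F := by
    ext φ
    refine (hY.apply_eq φ).trans ((h φ).trans ?_).symm
    simp [a]
  rw [this]
  exact hF.1

/-! ### Operations on homogeneous functions -/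

namespace HomogeneousFunction

variable {k l m : ℤ}

lemma contDiffAt (a : HomogeneousFunction k) {z : SpaceTime} (hz : z ≠ 0) : ContDiffAt ℝ ∞ a z :=
  a.smooth.contDiffAt (isOpen_compl_singleton.mem_nhds hz)

lemma differentiableAt (a : HomogeneousFunction k) {z : SpaceTime} (hz : z ≠ 0) :
    DifferentiableAt ℝ a z :=
  (a.contDiffAt hz).differentiableAt (by simp)

instance : Add (HomogeneousFunction k) where
  add a b := ⟨fun z => a z + b z, a.smooth.add b.smooth, fun c z hc hz => by
    rw [a.homogeneous c z hc hz, b.homogeneous c z hc hz]; ring⟩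

instance : Neg (HomogeneousFunction k) where
  neg a := ⟨fun z => -a z, a.smooth.neg, fun c z hc hz => by
    rw [a.homogeneous c z hc hz]; ring⟩

instance : SMul ℝ (HomogeneousFunction k) where
  smul r a := ⟨fun z => r * a z, contDiffOn_const.mul a.smooth, fun c z hc hz => by
    rw [a.homogeneous c z hc hz]; ring⟩

@[simp] lemma add_apply (a b : HomogeneousFunction k) (z : SpaceTime) : (a + b) z = a z + b z := rfl

@[simp] lemma neg_apply (a : HomogeneousFunction k) (z : SpaceTime) : (-a) z = -a z := rfl

@[simp] lemma smul_apply (r : ℝ) (a : HomogeneousFunction k) (z : SpaceTime) :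
    (r • a) z = r * a z := rfl

/-- The sum of three homogeneous functions. -/
def sum (a : Fin 3 → HomogeneousFunction k) : HomogeneousFunction k :=
  a 0 + a 1 + a 2

@[simp] lemma sum_apply (a : Fin 3 → HomogeneousFunction k) (z : SpaceTime) :
    sum a z = ∑ j, a j z := by
  simp [sum, Fin.sum_univ_three]

/-- The product of homogeneous functions. -/
def mul (a : HomogeneousFunction k) (b : HomogeneousFunction l) (h : k + l = m) :
    HomogeneousFunction m :=
  ⟨fun z => a z * b z, a.smooth.mul b.smooth, fun c z hc hz => by
    rw [a.homogeneous c z hc hz, b.homogeneous c z hc hz, ← h, zpow_add₀ hc.ne']; ring⟩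

@[simp] lemma mul_apply (a : HomogeneousFunction k) (b : HomogeneousFunction l) (h : k + l = m)
    (z : SpaceTime) : a.mul b h z = a z * b z := rfl

/-- The inverse of a nowhere vanishing homogeneous function. -/
noncomputable def inv (a : HomogeneousFunction k) (ha : ∀ z ≠ 0, a z ≠ 0) (h : -k = m) :
    HomogeneousFunction m :=
  ⟨fun z => (a z)⁻¹, a.smooth.inv fun z hz => ha z hz, fun c z hc hz => by
    rw [a.homogeneous c z hc hz, ← h, mul_inv, zpow_neg]⟩

@[simp] lemma inv_apply (a : HomogeneousFunction k) (ha : ∀ z ≠ 0, a z ≠ 0) (h : -k = m)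
    (z : SpaceTime) : a.inv ha h z = (a z)⁻¹ := rfl

/-- The derivative of a homogeneous function in a fixed direction. -/
noncomputable def deriv (a : HomogeneousFunction k) (w : SpaceTime) (h : k - 1 = m) :
    HomogeneousFunction m :=
  ⟨fun z => fderiv ℝ a z w, by
    have h1 : ContDiffOn ℝ ∞ (fderiv ℝ a) {0}ᶜ :=
      a.smooth.fderiv_of_isOpen isOpen_compl_singleton (by simp)
    exact h1.clm_apply contDiffOn_const, fun c z hc hz => by
    have hcz : c • z ≠ 0 := smul_ne_zero hc.ne' hz
    have h1 : HasFDerivAt (fun y => a (c • y)) ((fderiv ℝ a (c • z)).comp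
        (c • ContinuousLinearMap.id ℝ SpaceTime)) z :=
      (a.differentiableAt hcz).hasFDerivAt.comp z
        ((c • ContinuousLinearMap.id ℝ SpaceTime).hasFDerivAt)
    have h2 : (fun y => a (c • y)) =ᶠ[𝓝 z] fun y => c ^ k * a y := by
      filter_upwards [isOpen_compl_singleton.mem_nhds hz] with y hy
      exact a.homogeneous c y hc hy
    have h3 := (h1.congr_of_eventuallyEq h2.symm).unique
      ((a.differentiableAt hz).hasFDerivAt.const_mul (c ^ k))
    have h4 := congrArg (fun L => L w) h3
    simp only [ContinuousLinearMap.comp_apply, _root_.smul_apply,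
      ContinuousLinearMap.id_apply, map_smul, smul_eq_mul] at h4
    rw [← h, zpow_sub_one₀ hc.ne']
    field_simp
    linarith⟩

lemma lineDeriv_mulTest (a : HomogeneousFunction k) (w : SpaceTime) (h : k - 1 = m)
    (φ : PuncturedTest) :
    ∂_{w} (a.mulTest φ) = (a.deriv w h).mulTest φ + a.mulTest (∂_{w} φ) := by
  ext z
  change _ = fderiv ℝ a z w * φ z + a z * (∂_{w} φ : PuncturedTest) z
  rw [lineDeriv_test_apply, lineDeriv_test_apply]
  -- At the origin `a` need not be differentiable, but `φ` vanishes nearby and both sides are zero.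
  by_cases hz : z = 0
  · have h0 : z ∉ tsupport φ := fun hh => φ.tsupport_subset hh hz
    have h1 : z ∉ tsupport (a.mulTest φ) := fun hh => h0 (tsupport_mul_subset_right hh)
    rw [image_eq_zero_of_notMem_tsupport h0,
      image_eq_zero_of_notMem_tsupport fun hh => h0 (tsupport_fderiv_subset ℝ hh),
      image_eq_zero_of_notMem_tsupport fun hh => h1 (tsupport_fderiv_subset ℝ hh)]
    simp
  · have h1 := (a.differentiableAt hz).hasFDerivAt.mul (differentiable_test φ z).hasFDerivAt
    have h2 : fderiv ℝ (a.mulTest φ) z = _ := h1.fderiv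
    rw [h2]
    simp
    ring

lemma mulTest_add (a : HomogeneousFunction k) (φ ψ : PuncturedTest) :
    a.mulTest (φ + ψ) = a.mulTest φ + a.mulTest ψ := by
  ext z
  exact mul_add _ _ _

lemma mul_mulTest (a : HomogeneousFunction k) (b : HomogeneousFunction l) (h : k + l = m)
    (φ : PuncturedTest) : (a.mul b h).mulTest φ = a.mulTest (b.mulTest φ) := by
  ext z
  exact mul_assoc _ _ _

lemma add_mulTest (a b : HomogeneousFunction k) (φ : PuncturedTest) :
    (a + b).mulTest φ = a.mulTest φ + b.mulTest φ := by
  ext z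
  exact add_mul _ _ _

lemma neg_mulTest (a : HomogeneousFunction k) (φ : PuncturedTest) :
    (-a).mulTest φ = -a.mulTest φ := by
  ext z
  exact neg_mul _ _

end HomogeneousFunction

/-! ### The tangential vector fields of the cone -/

/-- The time coordinate. -/
def timeCoord : HomogeneousFunction 1 :=
  ⟨fun z => z.1, contDiff_fst.contDiffOn, fun c z _ _ => by simp⟩

/-- The space coordinates. -/
def spaceCoord (j : Fin 3) : HomogeneousFunction 1 :=
  ⟨fun z => z.2 j, ((EuclideanSpace.proj j : Space →L[ℝ] ℝ).contDiff.comp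
    contDiff_snd).contDiffOn, fun c z _ _ => by simp⟩

@[simp] lemma timeCoord_apply (z : SpaceTime) : timeCoord z = z.1 := rfl

@[simp] lemma spaceCoord_apply (j : Fin 3) (z : SpaceTime) : spaceCoord j z = z.2 j := rfl

/-- Integration over the cone, as a linear form on test functions on `ℝ⁴ ∖ 0`. -/
noncomputable def coneForm : PuncturedTest →ₗ[ℝ] ℝ where
  toFun φ := coneIntegral φ
  map_add' φ ψ := by
    rw [coneIntegral, coneIntegral, coneIntegral, ← integral_add
      (integrable_inv_norm_mul_cone φ.continuous φ.hasCompactSupport)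
      (integrable_inv_norm_mul_cone ψ.continuous ψ.hasCompactSupport)]
    exact integral_congr_ae (ae_of_all _ fun x => mul_add _ _ _)
  map_smul' c φ := by
    rw [coneIntegral, coneIntegral, smul_eq_mul, ← integral_const_mul]
    exact integral_congr_ae (ae_of_all _ fun x => mul_left_comm _ _ _)

lemma coneForm_congr {φ ψ : PuncturedTest} (h : ∀ x ≠ 0, φ (cone x) = ψ (cone x)) :
    coneForm φ = coneForm ψ := by
  refine integral_congr_ae ?_
  filter_upwards [ae_ne_zero] with x hx
  rw [h x hx]

/-- The Lorentz boost `xⱼ ∂ₜ + t ∂ⱼ`. -/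
noncomputable def boost (j : Fin 3) (φ : PuncturedTest) : PuncturedTest :=
  (spaceCoord j).mulTest (∂_{dir 0} φ) + timeCoord.mulTest (∂_{dir j.succ} φ)

/-- On the cone `|x|⁻¹ Lⱼφ` is the `j`-th partial derivative of `x ↦ φ(|x|, x)`, whose integral
vanishes. -/
lemma coneForm_boost (j : Fin 3) (φ : PuncturedTest) : coneForm (boost j φ) = 0 := by
  refine integral_eq_zero_of_hasLineDerivAt (by simp [Space]) (basisVec_ne_zero j)
    (f := fun x => φ (cone x)) ?_
    (integrable_inv_norm_mul_cone (boost j φ).continuous (boost j φ).hasCompactSupport) ?_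
  · exact (φ.continuous.comp continuous_cone).integrable_of_hasCompactSupport
      (hasCompactSupport_comp_cone φ.hasCompactSupport)
  · intro x hx
    have h0 : ‖x‖ ≠ 0 := norm_ne_zero_iff.2 hx
    convert! hasLineDerivAt_comp_cone hx (differentiable_test φ _) j using 1
    change ‖x‖⁻¹ * (x j * (∂_{dir 0} φ : PuncturedTest) (cone x) +
      ‖x‖ * (∂_{dir j.succ} φ : PuncturedTest) (cone x)) = _
    rw [lineDeriv_test_apply, lineDeriv_test_apply]
    field_simp

/-- The Lorentz boost of a homogeneous function. -/
noncomputable def HomogeneousFunction.boost {k : ℤ} (c : HomogeneousFunction k) (j : Fin 3) :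
    HomogeneousFunction k :=
  (spaceCoord j).mul (c.deriv (dir 0) rfl) (by ring) +
    timeCoord.mul (c.deriv (dir j.succ) rfl) (by ring)

lemma boost_mulTest {k : ℤ} (c : HomogeneousFunction k) (j : Fin 3) (φ : PuncturedTest) :
    boost j (c.mulTest φ) = (c.boost j).mulTest φ + c.mulTest (boost j φ) := by
  rw [boost, c.lineDeriv_mulTest _ rfl, c.lineDeriv_mulTest _ rfl]
  ext z
  change z.2 j * (_ * φ z + c z * _) + z.1 * (_ * φ z + c z * _) = (z.2 j * _ + z.1 * _) * φ z +
    c z * (z.2 j * _ + z.1 * _)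
  ring

lemma coneForm_mulTest_boost {k : ℤ} (c : HomogeneousFunction k) (j : Fin 3) (φ : PuncturedTest) :
    coneForm (c.mulTest (boost j φ)) = -coneForm ((c.boost j).mulTest φ) := by
  have h := coneForm_boost j (c.mulTest φ)
  rw [boost_mulTest, map_add] at h
  linarith

/-! ### The coefficients of the first order division formula -/

section Coefficients

variable {v : Space} (hv : ‖v‖ < 1)

lemma half_sq_pos {z : SpaceTime} (hz : z ≠ 0) : 0 < (z.1 ^ 2 + ‖z.2‖ ^ 2) / 2 := by
  rcases eq_or_ne z.1 0 with h | h
  · have : z.2 ≠ 0 := fun h2 => hz (Prod.ext h h2)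
    have := norm_pos_iff.2 this
    positivity
  · positivity

/-- The function `(t² + |x|²) / 2`, equal to `t²` on the cone. -/
noncomputable def halfSq : HomogeneousFunction 2 :=
  ⟨fun z => (z.1 ^ 2 + ‖z.2‖ ^ 2) / 2, (((contDiff_fst.pow 2).add
    ((contDiff_norm_sq ℝ).comp contDiff_snd)).div_const 2).contDiffOn, fun c z hc _ => by
    simp [norm_smul, mul_pow]
    ring⟩

variable (v) in
/-- The function `(t² + |x|²) / 2 - t v·x`, equal to `t (t - v·x)` on the cone. -/
noncomputable def denom : HomogeneousFunction 2 :=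
  ⟨fun z => (z.1 ^ 2 + ‖z.2‖ ^ 2) / 2 - z.1 * inner ℝ v z.2, ((((contDiff_fst.pow 2).add
    ((contDiff_norm_sq ℝ).comp contDiff_snd)).div_const 2).sub
    (contDiff_fst.mul (contDiff_const.inner ℝ contDiff_snd))).contDiffOn, fun c z hc _ => by
    simp [norm_smul, mul_pow, inner_smul_right]
    ring⟩

lemma halfSq_apply (z : SpaceTime) : halfSq z = (z.1 ^ 2 + ‖z.2‖ ^ 2) / 2 := rfl

lemma denom_apply (z : SpaceTime) :
    denom v z = (z.1 ^ 2 + ‖z.2‖ ^ 2) / 2 - z.1 * inner ℝ v z.2 := rfl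

lemma halfSq_ne_zero (z : SpaceTime) (hz : z ≠ 0) : halfSq z ≠ 0 := (half_sq_pos hz).ne'

/-- `t (t - v·x)` vanishes at points off the cone, where the coefficients must still be smooth;
`denom` agrees with it on the cone and is positive off the origin, because `|t v·x| ≤ |v| (t² +
|x|²) / 2`. `halfSq` replaces `t²` in the same way. -/
lemma denom_ne_zero (hv : ‖v‖ < 1) (z : SpaceTime) (hz : z ≠ 0) : denom v z ≠ 0 := by
  have h1 := half_sq_pos hz
  have h2 : |z.1 * inner ℝ v z.2| ≤ ‖v‖ * ((z.1 ^ 2 + ‖z.2‖ ^ 2) / 2) := by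
    rw [abs_mul]
    have h3 := abs_real_inner_le_norm v z.2
    have h4 : |z.1| * ‖z.2‖ ≤ (z.1 ^ 2 + ‖z.2‖ ^ 2) / 2 := by
      rw [← sq_abs z.1]
      linarith [two_mul_le_add_sq |z.1| ‖z.2‖]
    calc |z.1| * |inner ℝ v z.2| ≤ |z.1| * (‖v‖ * ‖z.2‖) :=
          mul_le_mul_of_nonneg_left h3 (abs_nonneg _)
      _ = ‖v‖ * (|z.1| * ‖z.2‖) := by ring
      _ ≤ _ := mul_le_mul_of_nonneg_left h4 (norm_nonneg _)
  have h5 : ‖v‖ * ((z.1 ^ 2 + ‖z.2‖ ^ 2) / 2) < (z.1 ^ 2 + ‖z.2‖ ^ 2) / 2 :=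
    mul_lt_of_lt_one_left h1 hv
  have := (le_abs_self _).trans h2
  rw [denom_apply]
  linarith

/-- The coefficients `aᵢ⁰`. -/
noncomputable def coeffZero : Fin 4 → HomogeneousFunction 0 :=
  Fin.cons ((timeCoord.mul timeCoord (m := 2) rfl).mul
      ((denom v).inv (denom_ne_zero hv) (m := -2) rfl) rfl)
    fun k => -(timeCoord.mul (spaceCoord k) (m := 2) rfl).mul
      ((denom v).inv (denom_ne_zero hv) (m := -2) rfl) rfl

/-- The coefficient of the Lorentz boosts in the expression of `aᵢ⁰ T - ∂ᵢ` on the cone. -/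
noncomputable def coeffBoost : Fin 4 → Fin 3 → HomogeneousFunction (-1) :=
  Fin.cons (fun j => v j • timeCoord.mul
      ((denom v).inv (denom_ne_zero hv) (m := -2) rfl) rfl)
    fun k j => -((if k = j then (1 : ℝ) else 0) • timeCoord.mul
      (halfSq.inv halfSq_ne_zero (m := -2) rfl) rfl +
      v j • (spaceCoord k).mul ((denom v).inv (denom_ne_zero hv) (m := -2) rfl) rfl)

/-- The coefficients `aᵢ¹`. -/
noncomputable def coeffOne (i : Fin 4) : HomogeneousFunction (-1) :=
  -HomogeneousFunction.sum fun j => (coeffBoost hv i j).boost j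

lemma lineDeriv_stream_apply (φ : PuncturedTest) (z : SpaceTime) :
    (∂_{((1, v) : SpaceTime)} φ : PuncturedTest) z = (∂_{dir 0} φ : PuncturedTest) z +
      ∑ j : Fin 3, v j * (∂_{dir j.succ} φ : PuncturedTest) z := by
  have h : ((1, v) : SpaceTime) = dir 0 + ∑ j : Fin 3, v j • dir j.succ := by
    simp only [dir_zero, dir_succ, Fin.sum_univ_three]
    ext j
    · simp
    · fin_cases j <;> simp
  simp only [lineDeriv_test_apply]
  rw [h, map_add, _root_.map_sum]
  simp only [map_smul, smul_eq_mul]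

lemma boost_apply_cone (j : Fin 3) (φ : PuncturedTest) (x : Space) : boost j φ (cone x) =
    x j * (∂_{dir 0} φ : PuncturedTest) (cone x) +
      ‖x‖ * (∂_{dir j.succ} φ : PuncturedTest) (cone x) := rfl

/-- Substituting `∂ⱼ = (Lⱼ - xⱼ ∂ₜ) / t` in `T` gives `T = (1 - v·x/t) ∂ₜ + ∑ vⱼ Lⱼ / t`. Solving
for `∂ₜ`, then for `∂ₖ`, yields the coefficients. -/
lemma lineDeriv_cone (i : Fin 4) (φ : PuncturedTest) {x : Space} (hx : x ≠ 0) :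
    (∂_{dir i} φ : PuncturedTest) (cone x) =
      coeffZero hv i (cone x) * (∂_{((1, v) : SpaceTime)} φ : PuncturedTest) (cone x) -
      ∑ j, coeffBoost hv i j (cone x) * boost j φ (cone x) := by
  have hd : denom v (cone x) = ‖x‖ ^ 2 - ‖x‖ * (∑ j, v j * x j) := by
    rw [denom_apply, PiLp.inner_apply]
    simp [cone, mul_comm]
  have hd0 := denom_ne_zero hv _ (cone_ne_zero hx)
  have hn : halfSq (cone x) = ‖x‖ ^ 2 := by
    rw [halfSq_apply]
    simp [cone]
  have h0 : ‖x‖ ≠ 0 := norm_ne_zero_iff.2 hx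
  have ht : (cone x).1 = ‖x‖ := rfl
  have hs : (cone x).2 = x := rfl
  simp only [lineDeriv_stream_apply, boost_apply_cone]
  obtain ⟨p, hp⟩ : ∃ p, (∂_{dir 0} φ : PuncturedTest) (cone x) = p := ⟨_, rfl⟩
  obtain ⟨q, hq⟩ : ∃ q : Fin 3 → ℝ, ∀ j : Fin 3,
      (∂_{dir j.succ} φ : PuncturedTest) (cone x) = q j := ⟨_, fun _ => rfl⟩
  have hdv : (denom v (cone x))⁻¹ * (‖x‖ ^ 2 - ‖x‖ * (∑ j, v j * x j)) = 1 := by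
    rw [← hd, inv_mul_cancel₀ hd0]
  have hnv : ‖x‖⁻¹ * ‖x‖ = 1 := inv_mul_cancel₀ h0
  simp only [Fin.sum_univ_three] at hdv
  simp only [hp, hq]
  refine Fin.cases ?_ (fun k => ?_) i
  · rw [hp]
    simp only [coeffZero, coeffBoost, Fin.cons_zero, HomogeneousFunction.mul_apply,
      HomogeneousFunction.inv_apply, HomogeneousFunction.smul_apply, timeCoord_apply, ht,
      Fin.sum_univ_three]
    linear_combination (-p) * hdv
  · rw [hq]
    simp only [coeffZero, coeffBoost, Fin.cons_succ, HomogeneousFunction.mul_apply,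
      HomogeneousFunction.inv_apply, HomogeneousFunction.smul_apply, timeCoord_apply,
      spaceCoord_apply, ht, hs, hn, HomogeneousFunction.neg_apply, HomogeneousFunction.add_apply,
      Fin.sum_univ_three]
    have hk : ∑ j, (if k = j then (1 : ℝ) else 0) * (x j * p + ‖x‖ * q j) =
        x k * p + ‖x‖ * q k := by simp
    simp only [Fin.sum_univ_three] at hk
    have hn2 : ‖x‖ * (‖x‖ ^ 2)⁻¹ = ‖x‖⁻¹ := by field_simp
    simp only [hn2]
    linear_combination (-‖x‖⁻¹) * hk - (q k) * hnv + (‖x‖⁻¹ * x k * p) * hdv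
      + (-(x k) * p * (denom v (cone x))⁻¹ * ‖x‖ +
        x k * p * (denom v (cone x))⁻¹ * (v 0 * x 0 + v 1 * x 1 + v 2 * x 2)) * hnv

/-- The division formula of first order off the origin. -/
lemma coneForm_lineDeriv (i : Fin 4) (φ : PuncturedTest) : coneForm (∂_{dir i} φ) =
    coneForm ((coeffZero hv i).mulTest (∂_{((1, v) : SpaceTime)} φ)) -
      coneForm ((coeffOne hv i).mulTest φ) := by
  have h1 : coneForm (∂_{dir i} φ) = coneForm ((coeffZero hv i).mulTest (∂_{((1, v) : SpaceTime)} φ)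
      - ∑ j, (coeffBoost hv i j).mulTest (boost j φ)) := by
    refine coneForm_congr fun x hx => ?_
    rw [lineDeriv_cone hv i φ hx]
    simp
  have h2 : (coeffOne hv i).mulTest φ = -∑ j, ((coeffBoost hv i j).boost j).mulTest φ := by
    ext z
    simp [coeffOne, Finset.sum_mul]
  rw [h1, h2, map_sub, map_neg, _root_.map_sum, _root_.map_sum]
  simp only [coneForm_mulTest_boost, Finset.sum_neg_distrib]

/-! ### The coefficients of the second order division formula -/

/-- The coefficients `bᵢⱼ⁰`. -/
noncomputable def coeffTwoZero (i j : Fin 4) : HomogeneousFunction 0 :=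
  (coeffZero hv i).mul (coeffZero hv j) rfl

/-- The coefficients `bᵢⱼ¹`. -/
noncomputable def coeffTwoOne (i j : Fin 4) : HomogeneousFunction (-1) :=
  -((coeffZero hv i).mul ((coeffZero hv j).deriv (1, v) (m := -1) rfl) (m := -1) rfl +
    -(coeffOne hv i).mul (coeffZero hv j) (m := -1) rfl +
    -(coeffZero hv j).deriv (dir i) (m := -1) rfl +
    -(coeffZero hv i).mul (coeffOne hv j) (m := -1) rfl)

/-- The coefficients `bᵢⱼ²`. -/
noncomputable def coeffTwoTwo (i j : Fin 4) : HomogeneousFunction (-2) :=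
  -(coeffZero hv i).mul ((coeffOne hv j).deriv (1, v) (m := -2) rfl) (m := -2) rfl +
    (coeffOne hv i).mul (coeffOne hv j) (m := -2) rfl + (coeffOne hv j).deriv (dir i) (m := -2) rfl

lemma lineDeriv_puncturedTest_comm (φ : PuncturedTest) (a b : SpaceTime) :
    ∂_{a} (∂_{b} φ) = ∂_{b} (∂_{a} φ) := by
  have h := lineDeriv_test_comm (extend φ) a b
  simp only [← extend_lineDeriv] at h
  ext z
  exact congrArg (fun f : Test => f z) h

/-- The division formula of second order off the origin. -/
lemma coneForm_lineDeriv_lineDeriv (i j : Fin 4) (φ : PuncturedTest) :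
    coneForm (∂_{dir j} (∂_{dir i} φ)) =
      coneForm ((coeffTwoZero hv i j).mulTest
        (∂_{((1, v) : SpaceTime)} (∂_{((1, v) : SpaceTime)} φ))) -
      coneForm ((coeffTwoOne hv i j).mulTest (∂_{((1, v) : SpaceTime)} φ)) +
      coneForm ((coeffTwoTwo hv i j).mulTest φ) := by
  -- After the formula for `∂ⱼ`, the remaining `∂ᵢ` is pulled out of `aⱼ⁰ ∂ᵢTφ` and `aⱼ¹ ∂ᵢφ` by
  -- Leibniz, and the formula for `∂ᵢ` is applied to the test functions `aⱼ⁰ Tφ` and `aⱼ¹ φ`.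
  rw [coneForm_lineDeriv hv j, lineDeriv_puncturedTest_comm φ (1, v) (dir i)]
  have h1 := (coeffZero hv j).lineDeriv_mulTest (dir i) (m := -1) rfl (∂_{((1, v) : SpaceTime)} φ)
  have h2 := (coeffOne hv j).lineDeriv_mulTest (dir i) (m := -2) rfl φ
  have h3 := coneForm_lineDeriv hv i ((coeffZero hv j).mulTest (∂_{((1, v) : SpaceTime)} φ))
  have h4 := coneForm_lineDeriv hv i ((coeffOne hv j).mulTest φ)
  rw [h1, (coeffZero hv j).lineDeriv_mulTest (1, v) (m := -1) rfl] at h3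
  rw [h2, (coeffOne hv j).lineDeriv_mulTest (1, v) (m := -2) rfl] at h4
  simp only [map_add, HomogeneousFunction.mulTest_add] at h3 h4
  simp only [coeffTwoZero, coeffTwoOne, coeffTwoTwo, HomogeneousFunction.add_mulTest,
    HomogeneousFunction.neg_mulTest, HomogeneousFunction.mul_mulTest, map_add, map_neg]
  linarith

end Coefficients

/-! ### The residue of a homogeneous extension of degree `-4` -/

/-- A smooth compactly supported radial function on `ℝ⁴`, equal to `1` near the origin. -/
noncomputable def radialTest : Test :=
  mkTest (fun z => Real.smoothTransition (2 - (z.1 ^ 2 + ‖z.2‖ ^ 2)))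
    (Real.smoothTransition.contDiff.comp (contDiff_const.sub ((contDiff_fst.pow 2).add
      ((contDiff_norm_sq ℝ).comp contDiff_snd)))) (by
    refine HasCompactSupport.intro (isCompact_closedBall 0 2) fun z hz => ?_
    refine Real.smoothTransition.zero_of_nonpos ?_
    rw [mem_closedBall_zero_iff, Prod.norm_def, max_le_iff, not_and_or, not_le, not_le] at hz
    rcases hz with h | h
    · rw [Real.norm_eq_abs] at h
      nlinarith [sq_abs z.1, sq_nonneg ‖z.2‖]
    · nlinarith [sq_nonneg z.1])

lemma radialTest_apply (z : SpaceTime) :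
    radialTest z = Real.smoothTransition (2 - (z.1 ^ 2 + ‖z.2‖ ^ 2)) := rfl

lemma radialTest_eq_one {z : SpaceTime} (hz : z.1 ^ 2 + ‖z.2‖ ^ 2 ≤ 1) : radialTest z = 1 :=
  Real.smoothTransition.one_of_one_le (by linarith)

/-- The difference of `radialTest` and its dilation by `2`, on the ray of the cone of length `r`. -/
noncomputable def radialDiff (r : ℝ) : ℝ :=
  Real.smoothTransition (2 - 2 * r ^ 2) - Real.smoothTransition (2 - r ^ 2 / 2)

/-- `radialTest` minus its dilation by `2`, a test function on `ℝ⁴ ∖ 0`. -/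
noncomputable def radialPunctured : PuncturedTest :=
  ⟨fun z => radialTest z - dilate 2 two_ne_zero radialTest z,
    radialTest.contDiff.sub (dilate 2 two_ne_zero radialTest).contDiff,
    radialTest.hasCompactSupport.sub (dilate 2 two_ne_zero radialTest).hasCompactSupport, by
      intro z hz hz0
      rw [mem_singleton_iff] at hz0
      subst hz0
      refine (notMem_tsupport_iff_eventuallyEq.2 ?_) hz
      have hc : Continuous fun z : SpaceTime => z.1 ^ 2 + ‖z.2‖ ^ 2 := by fun_prop
      have h1 : ∀ᶠ z : SpaceTime in 𝓝 0, z.1 ^ 2 + ‖z.2‖ ^ 2 < 1 :=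
        hc.continuousAt.eventually_lt_const (by simp)
      filter_upwards [h1] with z hz
      have h2 : ((2 : ℝ)⁻¹ • z).1 ^ 2 + ‖((2 : ℝ)⁻¹ • z).2‖ ^ 2 ≤ 1 := by
        simp only [Prod.smul_fst, Prod.smul_snd, norm_smul, smul_eq_mul, mul_pow]
        norm_num
        nlinarith [sq_nonneg z.1, sq_nonneg ‖z.2‖]
      simp [radialTest_eq_one hz.le, radialTest_eq_one h2]⟩

lemma radialPunctured_cone (x : Space) : radialPunctured (cone x) = radialDiff ‖x‖ := by
  change radialTest (cone x) - radialTest ((2 : ℝ)⁻¹ • cone x) = _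
  rw [radialTest_apply, radialTest_apply, radialDiff]
  simp only [cone, Prod.smul_fst, Prod.smul_snd, norm_smul, smul_eq_mul, norm_inv, Real.norm_ofNat]
  congr 2 <;> ring

lemma extend_radialPunctured :
    extend radialPunctured = radialTest - dilate 2 two_ne_zero radialTest := rfl

lemma radialDiff_nonpos (r : ℝ) : radialDiff r ≤ 0 := by
  have := Real.smoothTransition.monotone (show 2 - 2 * r ^ 2 ≤ 2 - r ^ 2 / 2 by
    nlinarith [sq_nonneg r])
  rw [radialDiff]
  linarith

lemma continuous_radialDiff : Continuous radialDiff := by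
  have := Real.smoothTransition.continuous
  unfold radialDiff
  fun_prop

lemma radialDiff_eq_zero {r : ℝ} (hr : r ^ 2 ≤ 1 / 2 ∨ 4 ≤ r ^ 2) : radialDiff r = 0 := by
  rcases hr with h | h
  · rw [radialDiff, Real.smoothTransition.one_of_one_le (by linarith),
      Real.smoothTransition.one_of_one_le (by linarith), sub_self]
  · rw [radialDiff, Real.smoothTransition.zero_of_nonpos (by linarith),
      Real.smoothTransition.zero_of_nonpos (by linarith), sub_self]

lemma integral_radialDiff_ne_zero : ∫ r in Ioi (0 : ℝ), r⁻¹ * radialDiff r ≠ 0 := by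
  have h0 : ∀ r : ℝ, r ≤ 1 / 2 → 0 ≤ r → radialDiff r = 0 := fun r h h' =>
    radialDiff_eq_zero (Or.inl (by nlinarith))
  -- `radialDiff` vanishes on `[0, 1/2]`, so replacing `r` by `max r (1/2)` in the weight leaves the
  -- integral over `r > 0` unchanged and makes the integrand continuous.
  have hcont : Continuous fun r : ℝ => (max r (1 / 2))⁻¹ * -radialDiff r := by
    have := continuous_radialDiff
    refine Continuous.mul (Continuous.inv₀ (by fun_prop) fun r => ?_) this.neg
    exact (lt_of_lt_of_le (by norm_num) (le_max_right r (1 / 2))).ne'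
  have hcs : HasCompactSupport fun r : ℝ => (max r (1 / 2))⁻¹ * -radialDiff r := by
    refine HasCompactSupport.intro (isCompact_Icc (a := (-2 : ℝ)) (b := 2)) fun r hr => ?_
    rw [radialDiff_eq_zero, neg_zero, mul_zero]
    right
    by_contra hlt
    exact hr (abs_le.1 (abs_le_of_sq_le_sq (by linarith) (by norm_num)))
  have heq : ∫ r in Ioi (0 : ℝ), r⁻¹ * radialDiff r =
      -∫ r in Ioi (0 : ℝ), (max r (1 / 2))⁻¹ * -radialDiff r := by
    rw [← integral_neg]
    refine setIntegral_congr_fun measurableSet_Ioi fun r hr => ?_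
    have hr0 : (0 : ℝ) < r := hr
    rcases le_total r (1 / 2) with h | h
    · simp [h0 r h hr0.le]
    · simp only [max_eq_left h]
      ring
  rw [heq, neg_ne_zero]
  have hnn : ∀ r : ℝ, 0 ≤ (max r (1 / 2))⁻¹ * -radialDiff r := fun r =>
    mul_nonneg (inv_nonneg.2 (le_trans (by norm_num) (le_max_right r (1 / 2))))
      (neg_nonneg.2 (radialDiff_nonpos r))
  refine (lt_of_lt_of_le ?_ (setIntegral_mono_set
    (hcont.integrable_of_hasCompactSupport hcs).integrableOn (ae_of_all _ hnn)
    (show Ioc (0 : ℝ) 2 ⊆ Ioi 0 from Ioc_subset_Ioi_self).eventuallyLE)).ne'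
  rw [← intervalIntegral.integral_of_le (by norm_num)]
  refine intervalIntegral.integral_pos (by norm_num) hcont.continuousOn (fun r _ => hnn r)
    ⟨1, by norm_num, ?_⟩
  rw [radialDiff, Real.smoothTransition.zero_of_nonpos (by norm_num),
    Real.smoothTransition.one_of_one_le (by norm_num)]
  norm_num

/-- If `b Y`, with `b` homogeneous of degree `-2`, has a homogeneous extension of degree `-4`, then
the integral of `b` over the sphere `{1} × S²` vanishes. -/
lemma IsHomogeneousExtension.integral_sphere_eq_zero {Y F : Dist}
    (hY : IsForwardFundamentalSolution Y) {b : HomogeneousFunction (-2)}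
    (hF : IsHomogeneousExtension (-4) b Y F) :
    ∫ y : Metric.sphere (0 : Space) 1, b (1, (y : Space)) ∂surfaceMeasure = 0 := by
  -- In degree `-4` the dilation factor is `2 ^ 0 = 1`.
  have h1 : F (extend radialPunctured) = 0 := by
    rw [extend_radialPunctured, map_sub, hF.1 2 two_pos]
    simp
  rw [hF.2, hY.apply_eq] at h1
  have h2 : coneIntegral (b.mulTest radialPunctured) = 0 := by
    have : (4 * Real.pi)⁻¹ ≠ 0 := by positivity
    exact (mul_eq_zero.1 h1).resolve_left this
  rw [coneIntegral, integral_polar (integrable_inv_norm_mul_cone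
    (b.mulTest radialPunctured).continuous (b.mulTest radialPunctured).hasCompactSupport)] at h2
  have h3 : ∀ y : Metric.sphere (0 : Space) 1, ∫ r in Ioi (0 : ℝ), r ^ 2 * (‖r • (y : Space)‖⁻¹ *
      b.mulTest radialPunctured (cone (r • (y : Space)))) =
      b (1, (y : Space)) * ∫ r in Ioi (0 : ℝ), r⁻¹ * radialDiff r := by
    intro y
    have hy : ‖(y : Space)‖ = 1 := mem_sphere_zero_iff_norm.1 y.2
    have hyc : cone (y : Space) = (1, (y : Space)) := by rw [cone, hy]
    rw [← integral_const_mul]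
    -- The powers `r²`, `r⁻¹` and `r⁻²` combine to `r⁻¹`, so the radial integral is the same for
    -- every direction.
    refine setIntegral_congr_fun measurableSet_Ioi fun r hr => ?_
    have hr0 : (0 : ℝ) < r := hr
    have hne : cone (y : Space) ≠ 0 := cone_ne_zero fun h => by simp [h] at hy
    simp only [HomogeneousFunction.mulTest_apply]
    rw [radialPunctured_cone, cone_smul hr0.le, b.homogeneous r _ hr0 hne, norm_smul, hy,
      Real.norm_of_nonneg hr0.le, mul_one, hyc, zpow_neg]
    field_simp
  rw [integral_congr_ae (ae_of_all _ h3), integral_mul_const] at h2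
  exact (mul_eq_zero.1 h2).resolve_right integral_radialDiff_ne_zero

lemma coneForm_eq {Y : Dist} (hY : IsForwardFundamentalSolution Y) (φ : PuncturedTest) :
    Y (extend φ) = (4 * Real.pi)⁻¹ * coneForm φ :=
  hY.apply_eq _

end WaveDivision

/-! ### The division formulas on all of `ℝ⁴` -/

open WaveDivision in
theorem lemma3p1 (v : WaveDivision.Space) (hv : ‖v‖ < 1)
    (Y : WaveDivision.Dist) (hY : WaveDivision.IsForwardFundamentalSolution Y) :
    (∃ (a0 : Fin 4 → WaveDivision.HomogeneousFunction 0)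
       (a1 : Fin 4 → WaveDivision.HomogeneousFunction (-1)),
      ∀ i : Fin 4, ∃ A0 A1 : WaveDivision.Dist,
        WaveDivision.IsUniqueHomogeneousExtension (-2) (a0 i) Y A0 ∧
        WaveDivision.IsUniqueHomogeneousExtension (-3) (a1 i) Y A1 ∧
        WaveDivision.partialD i Y = WaveDivision.stream v A0 + A1) ∧
    (∃ (b0 : Fin 4 → Fin 4 → WaveDivision.HomogeneousFunction 0)
       (b1 : Fin 4 → Fin 4 → WaveDivision.HomogeneousFunction (-1))
       (b2 : Fin 4 → Fin 4 → WaveDivision.HomogeneousFunction (-2)),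
      ∀ i j : Fin 4,
        (∃ B0 B1 : WaveDivision.Dist,
          WaveDivision.IsUniqueHomogeneousExtension (-2) (b0 i j) Y B0 ∧
          WaveDivision.IsUniqueHomogeneousExtension (-3) (b1 i j) Y B1 ∧
          ∃! B2 : WaveDivision.Dist,
            WaveDivision.IsHomogeneousExtension (-4) (b2 i j) Y B2 ∧
            WaveDivision.partialD i (WaveDivision.partialD j Y) =
              WaveDivision.stream v (WaveDivision.stream v B0) +
                WaveDivision.stream v B1 + B2) ∧
        ∫ y : Metric.sphere (0 : WaveDivision.Space) 1,
          b2 i j (1, (y : WaveDivision.Space)) ∂WaveDivision.surfaceMeasure = 0) := by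
  have hext0 := fun a : HomogeneousFunction 0 =>
    exists_isHomogeneousExtension hY (m := -2) (by norm_num) (by norm_num) a
  have hext1 := fun a : HomogeneousFunction (-1) =>
    exists_isHomogeneousExtension hY (m := -3) (by norm_num) (by norm_num) a
  refine ⟨⟨coeffZero hv, coeffOne hv, fun i => ?_⟩,
    ⟨coeffTwoZero hv, coeffTwoOne hv, coeffTwoTwo hv, fun i j => ?_⟩⟩
  · obtain ⟨A0, hA0, -⟩ := hext0 (coeffZero hv i)
    obtain ⟨A1, hA1, -⟩ := hext1 (coeffOne hv i)
    refine ⟨A0, A1, hA0.unique (by norm_num), hA1.unique (by norm_num), ?_⟩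
    -- The difference of the two sides is homogeneous of degree `-3 > -4` and vanishes off the
    -- origin, hence is zero.
    rw [stream_eq, partialD, ← sub_eq_zero, ← sub_sub]
    refine eq_zero_of_isHomogeneous (m := -3) (by norm_num)
      (((hY.isHomogeneous.lineDeriv (by norm_num) _).sub
        (hA0.1.lineDeriv (by norm_num) _)).sub hA1.1) fun φ => ?_
    change (∂_{dir i} Y : Dist) (extend φ) - (∂_{((1, v) : SpaceTime)} A0 : Dist) (extend φ) -
      A1 (extend φ) = 0
    rw [lineDeriv_dist_apply, lineDeriv_dist_apply, ← extend_lineDeriv, ← extend_lineDeriv, hA0.2,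
      hA1.2, coneForm_eq hY, coneForm_eq hY, coneForm_eq hY, coneForm_lineDeriv hv]
    ring
  · obtain ⟨B0, hB0, -⟩ := hext0 (coeffTwoZero hv i j)
    obtain ⟨B1, hB1, -⟩ := hext1 (coeffTwoOne hv i j)
    -- The remainder is the only candidate for `B2`. What needs proof is that off the origin it is
    -- the product `bᵢⱼ² Y`.
    have hB2 : IsHomogeneousExtension (-4) (coeffTwoTwo hv i j) Y
        (partialD i (partialD j Y) - stream v (stream v B0) - stream v B1) := by
      simp only [stream_eq, partialD]
      refine ⟨(((hY.isHomogeneous.lineDeriv (n := -3) (by norm_num) _).lineDeriv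
        (by norm_num) _).sub ((hB0.1.lineDeriv (n := -3) (by norm_num) _).lineDeriv
        (by norm_num) _)).sub (hB1.1.lineDeriv (by norm_num) _), fun φ => ?_⟩
      change (∂_{dir i} (∂_{dir j} Y) : Dist) (extend φ) -
        (∂_{((1, v) : SpaceTime)} (∂_{((1, v) : SpaceTime)} B0) : Dist) (extend φ) -
        (∂_{((1, v) : SpaceTime)} B1 : Dist) (extend φ) = _
      simp only [lineDeriv_dist_apply, ← extend_lineDeriv]
      rw [hB0.2, hB1.2, coneForm_eq hY, coneForm_eq hY, coneForm_eq hY, coneForm_eq hY,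
        coneForm_lineDeriv_lineDeriv hv i j]
      ring
    refine ⟨⟨B0, B1, hB0.unique (by norm_num), hB1.unique (by norm_num), _, ⟨hB2, by abel⟩, ?_⟩,
      hB2.integral_sphere_eq_zero hY⟩
    rintro G ⟨-, hG⟩
    rw [hG]
    abel
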